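/- All circuits are on $n$ qubits. An architecture is a graph on the $n$ qubits together with a sequence of gate locations, each of which is a vertex (a single-qubit gate, of dimension $2$) or an edge (a two-qubit gate, of dimension $4$). A circuit is the sequence of its unitary gates at these locations, and also gives the corresponding operator on $(\mathbb C^2)^{\otimes n}$; $m$ is its number of gates. Given a worst-case circuit $C$ and a real number $\theta$, the interpolated circuit $C(\theta)$ is defined for three families. * **Haar random circuits.** $C$ has arbitrary unitary gates $G_1,\dots,G_m$, and $C(\theta)$ has the gates $H_j\exp(-\tfrac{\theta}{m}\log H_j)\,G_j$. Here $H_1,\dots,H_m$ are independent Haar random unitary gates, and $\log$ replaces each eigenvalue $e^{i\varphi}$, $\varphi\in(-\pi,\pi]$, by $i\varphi$ and keeps the eigenvectors. * **QAOA circuits with $p=1$.** $C=C_XC_Z$. The operator $C_Z$ is the product of $m_z$ gates $\sum_k e^{ih_k}|z_k\rangle\langle z_k|$, diagonal in the $Z$ basis, at the locations of an architecture. The operator $C_X$ is the product of one single-qubit gate $\sum_k e^{ih_k}|x_k\rangle\langle x_k|$ on each qubit, diagonal in the $X$ basis. The phases $h_k$ are arbitrary real numbers, and $m=m_z+n$.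 In $C(\theta)$, each phase $h_k$ is replaced by $h_k+(1-\tfrac{\theta}{m})\phi_k$ with random phases $\phi_k$, which are independent for different gates. For the $X$ gates the $\phi_k$ are independent and uniform on $[0,2\pi)$. For a $Z$ gate of dimension $d$, $\phi_k=\sum_{l=1}^d b_{kl}\xi_l$ with fixed real coefficients $b_{kl}$ and independent real random variables $\xi_l$, whose distributions have the following regularity: each has a density $f$ such that the total variation of the function $x\mapsto xf(x)$ on $\mathbb R$ is at most $V$, where $V$ is a constant. (The case $b_{kl}=\delta_{kl}$ is that of independent phases. The condition holds for suitable $V$, for instance, for uniform distributions on $[0,a)$ and for centered normal distributions of any variance.) * **IQP circuits.** $C=H^{\otimes n}C_ZH^{\otimes n}$, where $H$ is the Hadamard gate and $C_Z$ is the product of $m$ gates $\sum_z e^{ih_z}|z\rangle\langle z|$, diagonal in the $Z$ basis, at the locations of an architecture, with arbitrary real $h_z$. In $C(\theta)$, each $h_z$ is replaced by $h_z+(1-\tfrac{\theta}{m})\phi_z$, with all $\phi_z$ (over all gates) independent and uniform on $[0,2\pi)$. Let $\mathcal H(\theta)$ be the distribution of the (gate sequence of the) circuit $C(\theta)$, so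 that $\mathcal H(0)$ is the distribution of the random circuit. **Theorem.** For each of the three families: 1. $C(m)=C$ for every realization of the random gates or phases. 2. For every $\varepsilon>0$ there is a constant $c>0$, depending only on $\varepsilon$ (and on $V$ for QAOA circuits), such that, for all $n$, all architectures, all worst-case circuits $C$, and every $N$ that is at least the dimension of each gate, $$0\le\theta\le\Delta:=\frac{c}{N}\quad\Longrightarrow\quad D_{TV}\big(\mathcal H(\theta),\mathcal H(0)\big)=\sup_E\big|\mathcal H(\theta)(E)-\mathcal H(0)(E)\big|\le\varepsilon .$$ -/

import Mathlib

open MeasureTheory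

noncomputable section

namespace RandomCircuit

/-! ### Architectures, gates and circuits -/

/-- A gate location on a connectivity graph: a vertex (a single-qubit gate) or an edge (a two-qubit
gate). -/
inductive Location {n : ℕ} (Γ : SimpleGraph (Fin n)) : Type
  | vertex (v : Fin n) : Location Γ
  | edge (e : Γ.edgeSet) : Location Γ

/-- The set of qubits on which a gate at the given location acts. -/
def Location.support {n : ℕ} {Γ : SimpleGraph (Fin n)} : Location Γ → Finset (Fin n)
  | .vertex v => {v}
  | .edge e => (e : Sym2 (Fin n)).toFinset

/-- An architecture on `n` qubits: a connectivity graph and a sequence of gate locations. -/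
structure Architecture (n : ℕ) where
  graph : SimpleGraph (Fin n)
  size : ℕ
  layout : Fin size → Location graph

/-- Labels of the computational (`Z`) basis states of a set `σ` of qubits. -/
abbrev Basis (σ : Type) : Type := σ → Fin 2

/-- Unitary gates acting on the set `σ` of qubits. -/
abbrev Gate (σ : Type) [Fintype σ] [DecidableEq σ] : Type :=
  Matrix.unitaryGroup (Basis σ) ℂ

instance gateMeasurableSpace (σ : Type) [Fintype σ] [DecidableEq σ] :
    MeasurableSpace (Gate σ) := borel _

instance gateBorelSpace (σ : Type) [Fintype σ] [DecidableEq σ] : BorelSpace (Gate σ) := ⟨rfl⟩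

section Norm

open scoped Matrix.Norms.L2Operator

instance gateCompactSpace (σ : Type) [Fintype σ] [DecidableEq σ] : CompactSpace (Gate σ) := by
  refine isCompact_iff_compactSpace.mp ?_
  have : ProperSpace (Matrix (Basis σ) (Basis σ) ℂ) := FiniteDimensional.proper ℂ _
  refine Metric.isCompact_of_isClosed_isBounded ?_ ?_
  · exact isClosed_unitary
  · refine (Metric.isBounded_closedBall (x := (0 : Matrix (Basis σ) (Basis σ) ℂ)) (r := 1)).subset ?_
    intro U hU
    rw [mem_closedBall_zero_iff]
    exact (CStarRing.norm_of_mem_unitary hU).le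

/-- The logarithm `log H` of a unitary gate: it has the eigenvectors of `H`, and the eigenvalue
`e^{iφ}` of `H`, with `φ ∈ (-π, π]`, is replaced by `iφ`. -/
def gateLog {σ : Type} [Fintype σ] [DecidableEq σ] (H : Gate σ) :
    Matrix (Basis σ) (Basis σ) ℂ :=
  cfc Complex.log (H : Matrix (Basis σ) (Basis σ) ℂ)

theorem star_gateLog {σ : Type} [Fintype σ] [DecidableEq σ] (H : Gate σ) :
    star (gateLog H) = -gateLog H := by
  unfold gateLog
  rw [← cfc_star, ← cfc_neg]
  refine cfc_congr ?_
  intro z hz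
  have hz1 : ‖z‖ = 1 := by
    have := spectrum.subset_circle_of_unitary H.2 hz
    simpa using this
  apply Complex.ext <;> simp [Complex.log_re, hz1]

/-- The unitary gate `exp(t log H)`, for real `t`. -/
def gatePow {σ : Type} [Fintype σ] [DecidableEq σ] (H : Gate σ) (t : ℝ) : Gate σ :=
  ⟨NormedSpace.exp (t • gateLog H), by
    let +nondep : NormedAlgebra ℚ (Matrix (Basis σ) (Basis σ) ℂ) := NormedAlgebra.restrictScalars ℚ ℂ _
    refine NormedSpace.exp_mem_unitary_of_mem_skewAdjoint ?_
    rw [skewAdjoint.mem_iff, star_smul, star_gateLog, smul_neg, star_trivial]⟩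

end Norm

/-- The gate `∑ z, e^{i φ z} |z⟩⟨z|`, where `z` runs over the `Z` basis of the qubits in `σ`. -/
def zGate {σ : Type} [Fintype σ] [DecidableEq σ] (φ : Basis σ → ℝ) : Gate σ :=
  ⟨Matrix.diagonal fun z => Complex.exp (Complex.I * (φ z : ℂ)), by
    rw [Matrix.mem_unitaryGroup_iff, Matrix.star_eq_conjTranspose, Matrix.diagonal_conjTranspose,
      Matrix.diagonal_mul_diagonal, ← Matrix.diagonal_one]
    congr 1
    funext z
    simp [← Complex.exp_conj, ← Complex.exp_add]⟩

/-- The tensor power `H^{⊗σ}` of the Hadamard matrix. -/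
def hadamardMatrix (σ : Type) [Fintype σ] : Matrix (Basis σ) (Basis σ) ℂ :=
  fun x y => ∏ i, (if x i = 1 ∧ y i = 1 then (-1 : ℂ) else 1) / (Real.sqrt 2 : ℂ)

theorem hadamardMatrix_mem (σ : Type) [Fintype σ] [DecidableEq σ] :
    hadamardMatrix σ ∈ Matrix.unitaryGroup (Basis σ) ℂ := by
  rw [Matrix.mem_unitaryGroup_iff]
  ext x y
  have h2 : (Real.sqrt 2 : ℂ) * (Real.sqrt 2 : ℂ) = 2 := by
    rw [← Complex.ofReal_mul, Real.mul_self_sqrt (by norm_num)]; norm_num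
  have h0 : (Real.sqrt 2 : ℂ) ≠ 0 := by
    intro h; rw [h] at h2; norm_num at h2
  have key : ∀ a b : Fin 2, ∑ c : Fin 2,
      ((if a = 1 ∧ c = 1 then (-1 : ℂ) else 1) / (Real.sqrt 2 : ℂ)) *
      star ((if b = 1 ∧ c = 1 then (-1 : ℂ) else 1) / (Real.sqrt 2 : ℂ)) =
      if a = b then 1 else 0 := by
    intro a b
    fin_cases a <;> fin_cases b <;> simp <;> field_simp <;> simp [sq, h2]; norm_num
  have : (hadamardMatrix σ * star (hadamardMatrix σ)) x y =
      ∏ i, ∑ c : Fin 2, ((if x i = 1 ∧ c = 1 then (-1 : ℂ) else 1) / (Real.sqrt 2 : ℂ)) *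
        star ((if y i = 1 ∧ c = 1 then (-1 : ℂ) else 1) / (Real.sqrt 2 : ℂ)) := by
    rw [Fintype.prod_sum, Matrix.mul_apply]
    refine Finset.sum_congr rfl fun z _ => ?_
    rw [Matrix.star_apply, hadamardMatrix, hadamardMatrix, star_prod, ← Finset.prod_mul_distrib]
  rw [this]
  simp only [key, Matrix.one_apply]
  rw [Finset.prod_ite_zero]
  simp [funext_iff]

/-- The Hadamard gate `H^{⊗σ}` on all the qubits in `σ`; it maps the `Z` basis to the `X` basis. -/
def hadamard (σ : Type) [Fintype σ] [DecidableEq σ] : Gate σ :=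
  ⟨hadamardMatrix σ, hadamardMatrix_mem σ⟩

/-- The gate `∑ k, e^{i φ k} |x_k⟩⟨x_k|`, where `|x_k⟩ = H^{⊗σ} |k⟩` runs over the `X` basis of the
qubits in `σ` (note that the Hadamard gate is its own inverse). -/
def xGate {σ : Type} [Fintype σ] [DecidableEq σ] (φ : Basis σ → ℝ) : Gate σ :=
  hadamard σ * zGate φ * hadamard σ

/-- A gate on the qubits in `S`, tensored with the identity on the remaining qubits. -/
def embed {n : ℕ} {S : Finset (Fin n)} (U : Gate S) :
    Matrix (Basis (Fin n)) (Basis (Fin n)) ℂ :=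
  fun x y => if ∀ i, i ∉ S → x i = y i then
    (U : Matrix (Basis S) (Basis S) ℂ) (fun i => x i) (fun i => y i) else 0

namespace Architecture

variable {n : ℕ} (A : Architecture n)

/-- The qubits on which the `j`-th gate acts. -/
abbrev supp (j : Fin A.size) : Finset (Fin n) := (A.layout j).support

/-- The dimension of the `j`-th gate: `2` for a single-qubit gate and `4` for a two-qubit gate. -/
def gateDim (j : Fin A.size) : ℕ := Fintype.card (Basis (A.supp j))

/-- A circuit with the architecture `A`: the sequence of its gates. -/
abbrev Circuit : Type := ∀ j : Fin A.size, Gate (A.supp j)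

/-- A family of real numbers (phases), one for each gate and each basis state of its qubits. -/
abbrev Phases : Type := ∀ j : Fin A.size, Basis (A.supp j) → ℝ

/-- The operator `G_1 ⋯ G_m` on `n` qubits. -/
def operator {A : Architecture n} (G : A.Circuit) : Matrix (Basis (Fin n)) (Basis (Fin n)) ℂ :=
  (List.ofFn fun j => embed (G j)).prod

end Architecture

/-! ### Probability -/

/-- The total variation distance `sup_E |μ(E) - ν(E)|`, over measurable `E`. -/
def tvDist {α : Type} [MeasurableSpace α] (μ ν : Measure α) : ℝ :=
  ⨆ E : {E : Set α // MeasurableSet E}, |μ.real E - ν.real E|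

/-- The uniform distribution on `[0, 2π)`. -/
def uniformPhase : Measure ℝ :=
  ProbabilityTheory.cond volume (Set.Ico 0 (2 * Real.pi))

/-- The probability distribution `μ` on the real line has a density `f` such that the total variation
of the function `x ↦ x f(x)` on the real line is at most `V`. -/
def HasDensityOfVariation (V : ℝ) (μ : Measure ℝ) : Prop :=
  IsProbabilityMeasure μ ∧ ∃ f : ℝ → ℝ, Measurable f ∧ (∀ x, 0 ≤ f x) ∧
    μ = volume.withDensity (fun x => ENNReal.ofReal (f x)) ∧
    eVariationOn (fun x => x * f x) Set.univ ≤ ENNReal.ofReal V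

/-- The Haar probability measure on the unitary gates on `σ`. -/
def haarGate (σ : Type) [Fintype σ] [DecidableEq σ] : Measure (Gate σ) := Measure.haarMeasure ⊤

/-! ### Haar random circuits -/

section Haar

variable {n : ℕ} {A : Architecture n}

/-- The interpolated circuit with gates `H_j exp(-(θ/m) log H_j) G_j`, where `m` is the number of
gates. -/
def haarInterp (G : A.Circuit) (θ : ℝ) (H : A.Circuit) : A.Circuit :=
  fun j => H j * gatePow (H j) (-(θ / A.size)) * G j

/-- The distribution of the interpolated circuit, for independent Haar random gates `H_j`. -/
def haarLaw (G : A.Circuit) (θ : ℝ) : Measure A.Circuit :=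
  (Measure.pi fun j => haarGate (A.supp j)).map (haarInterp G θ)

end Haar

/-! ### IQP circuits -/

section IQP

variable {n : ℕ} {A : Architecture n}

/-- The `Z` diagonal gates of the IQP circuit in which the phases of the gates are `h`. -/
def iqpCircuit (h : A.Phases) : A.Circuit := fun j => zGate (h j)

/-- The operator `H^{⊗n} C_Z H^{⊗n}` of an IQP circuit, where `C_Z` is given by its gates. -/
def iqpOperator (C : A.Circuit) : Matrix (Basis (Fin n)) (Basis (Fin n)) ℂ :=
  hadamardMatrix (Fin n) * A.operator C * hadamardMatrix (Fin n)

/-- The interpolated circuit with phases `h + (1 - θ/m) φ`, where `m` is the number of gates. -/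
def iqpInterp (h : A.Phases) (θ : ℝ) (φ : A.Phases) : A.Circuit :=
  fun j => zGate fun z => h j z + (1 - θ / A.size) * φ j z

/-- The distribution of the interpolated circuit, for independent and uniform phases `φ`. -/
def iqpLaw (h : A.Phases) (θ : ℝ) : Measure A.Circuit :=
  (Measure.pi fun _ => Measure.pi fun _ => uniformPhase).map (iqpInterp h θ)

end IQP

/-! ### QAOA circuits with `p = 1`

The `Z` gates have the architecture `A`; they are followed by one single-qubit `X` gate on every
qubit, so that there are `m = A.size + n` gates in total. -/

section QAOA

variable {n : ℕ}

/-- The gates of a QAOA circuit: the `Z` gates and the `X` gates. -/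
abbrev QAOACircuit (A : Architecture n) : Type :=
  A.Circuit × (∀ q : Fin n, Gate ({q} : Finset (Fin n)))

/-- The phases of the layer of `X` gates. -/
abbrev XPhases (n : ℕ) : Type := ∀ q : Fin n, Basis ({q} : Finset (Fin n)) → ℝ

variable {A : Architecture n}

/-- The QAOA circuit in which the phases of the `Z` gates are `hz` and those of the `X` gates are
`hx`. -/
def qaoaCircuit (hz : A.Phases) (hx : XPhases n) : QAOACircuit A :=
  (fun j => zGate (hz j), fun q => xGate (hx q))

/-- The operator `C_X C_Z` of a QAOA circuit (to be applied to the state `|+⟩^{⊗n}`). -/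
def qaoaOperator (C : QAOACircuit A) : Matrix (Basis (Fin n)) (Basis (Fin n)) ℂ :=
  (List.ofFn fun q => embed (C.2 q)).prod * A.operator C.1

/-- The interpolated circuit with phases `h + (1 - θ/m) φ`, where `m = A.size + n`. -/
def qaoaInterp (hz : A.Phases) (hx : XPhases n) (θ : ℝ) (φ : A.Phases × XPhases n) :
    QAOACircuit A :=
  (fun j => zGate fun z => hz j z + (1 - θ / ((A.size + n : ℕ) : ℝ)) * φ.1 j z,
   fun q => xGate fun k => hx q k + (1 - θ / ((A.size + n : ℕ) : ℝ)) * φ.2 q k)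

/-- The distribution of the phases of the `j`-th `Z` gate: they are the linear combinations, with
coefficient matrix `B`, of independent real random variables with the distributions `μ z`. -/
def zPhaseLaw {σ : Type} [Fintype σ] [DecidableEq σ] (B : Matrix (Basis σ) (Basis σ) ℝ)
    (μ : Basis σ → Measure ℝ) : Measure (Basis σ → ℝ) :=
  (Measure.pi μ).map fun ξ => B.mulVec ξ

/-- The distribution of the interpolated circuit: the phases of different gates are independent, the
phases of the `Z` gates are distributed as in `zPhaseLaw`, and those of the `X` gates are independent
and uniform. -/
def qaoaLaw (B : ∀ j, Matrix (Basis (A.supp j)) (Basis (A.supp j)) ℝ)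
    (μ : ∀ j, Basis (A.supp j) → Measure ℝ) (hz : A.Phases) (hx : XPhases n) (θ : ℝ) :
    Measure (QAOACircuit A) :=
  ((Measure.pi fun j => zPhaseLaw (B j) (μ j)).prod
    (Measure.pi fun _ => Measure.pi fun _ => uniformPhase)).map (qaoaInterp hz hx θ)

end QAOA

end RandomCircuit

end

open scoped ENNReal NNReal

/-! Part 1 is immediate: at θ = m each random phase gets the factor 0, and each Haar gate
contributes H_j^0 = 1.

For part 2, put s = 1 - θ/m. Interpolation only contracts the randomness. A random phase φ becomes
sφ, and H exp(-(θ/m) log H) is the power H^s. The worst-case gates or phases enter afterwards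
through a map that does not depend on θ. It therefore suffices to compare the law of a contracted
variable with the original law, one gate at a time.

The comparison is by a common part of mass c (`Overlap`). It survives measurable maps, its masses
multiply over independent factors, and it bounds the total variation distance by 1 - c. If each gate
has a common part of mass at least (1 - aθ/m)^k, with aθ ≤ 1, then Bernoulli's inequality bounds the
distance by kaθ, with no dependence on m.

Three estimates supply the mass for a single variable. For uniform phases, s times the law of sφ is
a restriction of the uniform law. For a density f with g(x) = x f(x) of bounded variation, the L¹
change of f under dilation is the integral of |g(x/s) - g(x)| dx/|x|. It is at most twice the
variation of g times 1/s - 1, because dx/|x| is dilation invariant. For Haar gates, concavity of the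
sine shows that H ↦ H^s shrinks Frobenius distances by a factor no smaller than s. Haar measure is
proportional to the Hausdorff measure of dimension D, the real dimension of the Hermitian matrices,
so s^D times the law of H^s is below Haar measure. -/

/-- The measures `μ` and `ν` have a common part of mass at least `c`. -/
def Overlap {α : Type*} [MeasurableSpace α] (c : ℝ≥0∞) (μ ν : Measure α) : Prop :=
  ∃ κ : Measure α, κ ≤ μ ∧ κ ≤ ν ∧ c ≤ κ Set.univ

/-! ### Common parts of measures -/

namespace Overlap

variable {α β : Type*} [MeasurableSpace α] [MeasurableSpace β] {c d : ℝ≥0∞} {μ ν : Measure α}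

theorem refl [IsProbabilityMeasure μ] (hc : c ≤ 1) : Overlap c μ μ :=
  ⟨μ, le_rfl, le_rfl, by simpa⟩

theorem mono (h : Overlap c μ ν) (hd : d ≤ c) : Overlap d μ ν :=
  let ⟨κ, h₁, h₂, h₃⟩ := h
  ⟨κ, h₁, h₂, hd.trans h₃⟩

theorem of_smul_le [IsProbabilityMeasure μ] (hc : c ≤ 1) (h : c • μ ≤ ν) : Overlap c μ ν := by
  refine ⟨c • μ, fun s => ?_, h, by simp⟩
  simpa using mul_le_mul_left hc (μ s)

theorem map {f : α → β} (h : Overlap c μ ν) (hf : Measurable f) :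
    Overlap c (μ.map f) (ν.map f) := by
  obtain ⟨κ, h₁, h₂, h₃⟩ := h
  refine ⟨κ.map f, Measure.map_mono h₁ hf, Measure.map_mono h₂ hf, ?_⟩
  rwa [Measure.map_apply hf MeasurableSet.univ, Set.preimage_univ]

theorem prod {μ' ν' : Measure β} [IsFiniteMeasure μ] [IsFiniteMeasure ν] [IsFiniteMeasure μ']
    [IsFiniteMeasure ν'] (h : Overlap c μ ν) (h' : Overlap d μ' ν') :
    Overlap (c * d) (μ.prod μ') (ν.prod ν') := by
  obtain ⟨κ, h₁, h₂, h₃⟩ := h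
  obtain ⟨κ', h₁', h₂', h₃'⟩ := h'
  have : IsFiniteMeasure κ := isFiniteMeasure_of_le μ h₁
  have : IsFiniteMeasure κ' := isFiniteMeasure_of_le μ' h₁'
  refine ⟨κ.prod κ', Measure.prod_mono h₁ h₁', Measure.prod_mono h₂ h₂', ?_⟩
  rw [← Set.univ_prod_univ, Measure.prod_prod]
  gcongr

end Overlap

theorem MeasureTheory.Measure.pi_mono {ι : Type*} [Fintype ι] {α : ι → Type*}
    [∀ i, MeasurableSpace (α i)] {μ ν : ∀ i, Measure (α i)} (h : ∀ i, μ i ≤ ν i) :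
    Measure.pi μ ≤ Measure.pi ν := by
  refine Measure.le_iff.2 fun s hs => ?_
  rw [Measure.pi, Measure.pi, toMeasure_apply _ _ hs, toMeasure_apply _ _ hs]
  refine OuterMeasure.le_pi.2 (fun t _ => (OuterMeasure.pi_pi_le _ t).trans ?_) s
  exact Finset.prod_le_prod' fun i _ => h i (t i)

theorem Overlap.pi {ι : Type*} [Fintype ι] {α : ι → Type*}
    [∀ i, MeasurableSpace (α i)] {μ ν : ∀ i, Measure (α i)} [∀ i, IsFiniteMeasure (μ i)]
    [∀ i, IsFiniteMeasure (ν i)] {c : ι → ℝ≥0∞} (h : ∀ i, Overlap (c i) (μ i) (ν i)) :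
    Overlap (∏ i, c i) (Measure.pi μ) (Measure.pi ν) := by
  choose κ h₁ h₂ h₃ using h
  have (i : ι) : IsFiniteMeasure (κ i) := isFiniteMeasure_of_le (μ i) (h₁ i)
  refine ⟨Measure.pi κ, Measure.pi_mono h₁,
    Measure.pi_mono h₂, ?_⟩
  rw [Measure.pi_univ]
  exact Finset.prod_le_prod' fun i _ => h₃ i

theorem Overlap.pi_const {ι : Type*} [Fintype ι] {α : ι → Type*}
    [∀ i, MeasurableSpace (α i)] {μ ν : ∀ i, Measure (α i)} [∀ i, IsFiniteMeasure (μ i)]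
    [∀ i, IsFiniteMeasure (ν i)] {c : ℝ≥0∞} (h : ∀ i, Overlap c (μ i) (ν i)) :
    Overlap (c ^ Fintype.card ι) (Measure.pi μ) (Measure.pi ν) := by
  simpa using Overlap.pi h

/-- A common part κ gives ρ(E) - τ(E) ≤ (1 - κ(Eᶜ)) - κ(E), which is 1 minus the total mass of κ. -/
theorem RandomCircuit.tvDist_le_of_overlap {α : Type} [MeasurableSpace α] {μ ν : Measure α}
    [IsProbabilityMeasure μ] [IsProbabilityMeasure ν] {c : ℝ}
    (h : Overlap (ENNReal.ofReal c) μ ν) : RandomCircuit.tvDist μ ν ≤ 1 - c := by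
  obtain ⟨κ, h₁, h₂, h₃⟩ := h
  have : IsFiniteMeasure κ := isFiniteMeasure_of_le μ h₁
  have hκ : c ≤ κ.real Set.univ := (ENNReal.ofReal_le_iff_le_toReal (by simp)).1 h₃
  have key {ρ τ : Measure α} [IsProbabilityMeasure ρ] [IsProbabilityMeasure τ] (h₁ : κ ≤ ρ)
      (h₂ : κ ≤ τ) {E : Set α} (hE : MeasurableSet E) : ρ.real E - τ.real E ≤ 1 - c := by
    have e₁ : κ.real Eᶜ ≤ ρ.real Eᶜ := ENNReal.toReal_mono (by simp) (h₁ _)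
    have e₂ : κ.real E ≤ τ.real E := ENNReal.toReal_mono (by simp) (h₂ _)
    rw [probReal_compl_eq_one_sub (μ := ρ) hE] at e₁
    have := measureReal_add_measureReal_compl (μ := κ) hE
    linarith
  have : Nonempty {E : Set α // MeasurableSet E} := ⟨⟨∅, MeasurableSet.empty⟩⟩
  refine ciSup_le fun E => abs_sub_le_iff.2 ⟨key h₁ h₂ E.2, key h₂ h₁ E.2⟩

/-! ### Contraction of uniform phases -/

namespace RandomCircuit

theorem volume_Ico_two_pi_ne_zero : volume (Set.Ico 0 (2 * Real.pi)) ≠ 0 := by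
  simp [Real.pi_pos]

instance isProbabilityMeasure_uniformPhase : IsProbabilityMeasure uniformPhase :=
  ProbabilityTheory.cond_isProbabilityMeasure_of_finite volume_Ico_two_pi_ne_zero
    (by simp [ENNReal.mul_eq_top])

/-- The contracted variable is uniform on [0, 2πs), with density larger by the factor 1/s.
Multiplying by s leaves the restriction of the uniform law to that interval. -/
theorem smul_map_uniformPhase_le {s : ℝ} (hs : 0 < s) (hs1 : s ≤ 1) :
    ENNReal.ofReal s • uniformPhase.map (s * ·) ≤ uniformPhase := by
  have hm : Measurable fun x : ℝ => s * x := by fun_prop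
  refine Measure.le_iff.2 fun E hE => ?_
  rw [Measure.smul_apply, Measure.map_apply hm hE, uniformPhase,
    ProbabilityTheory.cond_apply measurableSet_Ico, ProbabilityTheory.cond_apply measurableSet_Ico,
    smul_eq_mul, mul_left_comm]
  gcongr
  calc ENNReal.ofReal s * volume (Set.Ico 0 (2 * Real.pi) ∩ (s * ·) ⁻¹' E)
      ≤ ENNReal.ofReal s * volume ((s * ·) ⁻¹' (Set.Ico 0 (2 * Real.pi) ∩ E)) := by
        gcongr
        rintro x ⟨⟨h₀, h₁⟩, hx⟩
        exact ⟨⟨by positivity, by nlinarith⟩, hx⟩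
    _ = volume (Set.Ico 0 (2 * Real.pi) ∩ E) := by
        rw [Real.volume_preimage_mul_left hs.ne', ← mul_assoc, ← ENNReal.ofReal_mul hs.le,
          abs_of_pos (inv_pos.2 hs), mul_inv_cancel₀ hs.ne', ENNReal.ofReal_one, one_mul]

end RandomCircuit

/-! ### Dilations and bounded variation -/

theorem eVariationOn.tsum_int_le {g : ℝ → ℝ} {u : ℤ → ℝ} (hu : Monotone u) :
    ∑' k : ℤ, edist (g (u (k + 1))) (g (u k)) ≤ eVariationOn g Set.univ := by
  rw [ENNReal.tsum_eq_iSup_sum]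
  refine iSup_le fun s => ?_
  -- A finite set of integers lies in [-N, N), so a shift by N turns its sum into part of a
  -- variation sum indexed by naturals.
  obtain ⟨N, hN⟩ : ∃ N : ℕ, ∀ k ∈ s, k.natAbs < N :=
    ⟨s.sup Int.natAbs + 1, fun k hk => Nat.lt_succ_of_le (Finset.le_sup (f := Int.natAbs) hk)⟩
  have hsub : s ⊆ (Finset.range (2 * N)).image fun i : ℕ => (i : ℤ) - N := by
    intro k hk
    have := hN k hk
    exact Finset.mem_image.2 ⟨(k + N).toNat, by simp; omega, by omega⟩
  calc ∑ k ∈ s, edist (g (u (k + 1))) (g (u k))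
      ≤ ∑ k ∈ (Finset.range (2 * N)).image fun i : ℕ => (i : ℤ) - N,
          edist (g (u (k + 1))) (g (u k)) := Finset.sum_le_sum_of_subset hsub
    _ = ∑ i ∈ Finset.range (2 * N), edist (g (u (((i + 1 : ℕ) : ℤ) - N))) (g (u ((i : ℤ) - N))) := by
        rw [Finset.sum_image fun i _ j _ h => by simpa using h]
        refine Finset.sum_congr rfl fun i _ => ?_
        rw [show (i : ℤ) - N + 1 = ((i + 1 : ℕ) : ℤ) - N by push_cast; ring]
    _ ≤ eVariationOn g Set.univ :=
        eVariationOn.sum_le (f := g) (u := fun i : ℕ => u ((i : ℤ) - N)) (n := 2 * N)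
          (fun i j h => hu (by simpa using h)) (fun _ => Set.mem_univ _)

/-- A function of bounded variation has a small change under dilations, on average with respect to
the dilation invariant measure. -/
theorem lintegral_Ioi_edist_mul_le {g : ℝ → ℝ} (hg : Measurable g) {r : ℝ} (hr : 1 < r) :
    ∫⁻ x in Set.Ioi 0, edist (g (r * x)) (g x) * ENNReal.ofReal x⁻¹ ≤
      eVariationOn g Set.univ * ENNReal.ofReal (r - 1) := by
  have hr0 : 0 < r := one_pos.trans hr
  have hcov : Set.Ioi (0 : ℝ) ⊆ ⋃ k : ℤ, Set.Ico (r ^ k) (r ^ (k + 1)) := fun x hx =>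
    Set.mem_iUnion.2 (exists_mem_Ico_zpow hx hr)
  -- The substitution x = r^k y preserves dx/x and moves every shell onto [1, r).
  have hscale (k : ℤ) : ∫⁻ x in Set.Ico (r ^ k) (r ^ (k + 1)),
        edist (g (r * x)) (g x) * ENNReal.ofReal x⁻¹ =
      ∫⁻ y in Set.Ico 1 r,
        edist (g (r ^ (k + 1) * y)) (g (r ^ k * y)) * ENNReal.ofReal y⁻¹ := by
    have hk : 0 < r ^ k := zpow_pos hr0 k
    have himg : Set.Ico (r ^ k) (r ^ (k + 1)) = (r ^ k * ·) '' Set.Ico 1 r := by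
      rw [Set.image_mul_left_Ico hk, mul_one, zpow_add_one₀ hr0.ne']
    rw [himg, lintegral_image_eq_lintegral_abs_deriv_mul (f' := fun _ => r ^ k) measurableSet_Ico
      (fun x _ => by simpa using (hasDerivWithinAt_id x _).const_mul (r ^ k))
      (fun x _ y _ h => mul_left_cancel₀ hk.ne' h)]
    refine setLIntegral_congr_fun measurableSet_Ico fun y hy => ?_
    have hy0 : 0 < y := one_pos.trans_le hy.1
    rw [mul_left_comm, ← ENNReal.ofReal_mul (abs_nonneg _), abs_of_pos hk, zpow_add_one₀ hr0.ne',
      mul_comm (r ^ k) r, mul_assoc]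
    congr 2
    field_simp
  calc ∫⁻ x in Set.Ioi 0, edist (g (r * x)) (g x) * ENNReal.ofReal x⁻¹
      ≤ ∫⁻ x in ⋃ k : ℤ, Set.Ico (r ^ k) (r ^ (k + 1)),
          edist (g (r * x)) (g x) * ENNReal.ofReal x⁻¹ := lintegral_mono_set hcov
    _ ≤ ∑' k : ℤ, ∫⁻ x in Set.Ico (r ^ k) (r ^ (k + 1)),
          edist (g (r * x)) (g x) * ENNReal.ofReal x⁻¹ := lintegral_iUnion_le _ _
    _ = ∫⁻ y in Set.Ico 1 r, ∑' k : ℤ,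
          edist (g (r ^ (k + 1) * y)) (g (r ^ k * y)) * ENNReal.ofReal y⁻¹ := by
        simp_rw [hscale]
        rw [lintegral_tsum]
        intro k
        fun_prop
    -- For fixed y the points r^k y increase with k, so the sum is at most the variation. The weight
    -- 1/y is at most 1 on [1, r).
    _ ≤ ∫⁻ _ in Set.Ico 1 r, eVariationOn g Set.univ := by
        refine setLIntegral_mono measurable_const fun y hy => ?_
        have hy0 : 0 < y := one_pos.trans_le hy.1
        rw [ENNReal.tsum_mul_right]
        have h₁ := eVariationOn.tsum_int_le (g := g) (u := fun k : ℤ => r ^ k * y)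
          (fun i j h => mul_le_mul_of_nonneg_right (zpow_le_zpow_right₀ hr.le h) hy0.le)
        have h₂ : ENNReal.ofReal y⁻¹ ≤ 1 := by
          simpa using inv_le_one_of_one_le₀ hy.1
        simpa using mul_le_mul' h₁ h₂
    _ = eVariationOn g Set.univ * ENNReal.ofReal (r - 1) := by
        rw [setLIntegral_const, Real.volume_Ico]

theorem lintegral_edist_mul_le {g : ℝ → ℝ} (hg : Measurable g) {r : ℝ} (hr : 1 < r) :
    ∫⁻ x, edist (g (r * x)) (g x) * ENNReal.ofReal |x|⁻¹ ≤
      2 * (eVariationOn g Set.univ * ENNReal.ofReal (r - 1)) := by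
  have hpos : ∫⁻ x in Set.Ioi 0, edist (g (r * x)) (g x) * ENNReal.ofReal |x|⁻¹ ≤
      eVariationOn g Set.univ * ENNReal.ofReal (r - 1) := by
    refine le_of_eq_of_le ?_ (lintegral_Ioi_edist_mul_le hg hr)
    refine setLIntegral_congr_fun measurableSet_Ioi fun x hx => ?_
    rw [abs_of_pos hx]
  -- Reflection reduces to the positive half-line, since an antitone change of variable does not
  -- increase the variation.
  have hneg : ∫⁻ x in Set.Iio 0, edist (g (r * x)) (g x) * ENNReal.ofReal |x|⁻¹ ≤
      eVariationOn g Set.univ * ENNReal.ofReal (r - 1) := by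
    have himg : Set.Iio (0 : ℝ) = (fun x => -x) '' Set.Ioi 0 := by simp
    rw [himg, lintegral_image_eq_lintegral_abs_deriv_mul (f' := fun _ => -1) measurableSet_Ioi
      (fun x _ => (hasDerivWithinAt_neg x _)) neg_injective.injOn]
    refine le_trans ?_ ((lintegral_Ioi_edist_mul_le (hg.comp measurable_neg) hr).trans
      (mul_le_mul_left (eVariationOn.comp_le_of_antitoneOn g (fun x : ℝ => -x)
        (fun x _ y _ h => neg_le_neg h) (Set.mapsTo_univ _ _)) _))
    refine le_of_eq (setLIntegral_congr_fun measurableSet_Ioi fun x hx => ?_)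
    simp [abs_of_pos (Set.mem_Ioi.1 hx)]
  have hu : Set.univ = Set.Iio (0 : ℝ) ∪ ({0} ∪ Set.Ioi 0) := by
    ext x; rcases lt_trichotomy x 0 with h | h | h <;> simp [h]
  have h0 : ∫⁻ x in {(0 : ℝ)}, edist (g (r * x)) (g x) * ENNReal.ofReal |x|⁻¹ = 0 :=
    setLIntegral_measure_zero _ _ (by simp)
  rw [← setLIntegral_univ (fun x => _ * _), two_mul, setLIntegral_congr (Filter.EventuallyEq.of_eq hu)]
  refine (lintegral_union_le _ _ _).trans (add_le_add hneg ?_)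
  refine (lintegral_union_le _ _ _).trans ?_
  rwa [h0, zero_add]

theorem map_mul_withDensity {p : ℝ → ℝ≥0∞} {s : ℝ} (hs : 0 < s) :
    (volume.withDensity p).map (s * ·) =
      volume.withDensity fun x => ENNReal.ofReal s⁻¹ * p (s⁻¹ * x) := by
  have hm : Measurable fun x : ℝ => s * x := by fun_prop
  ext E hE
  have himg : (s * ·) ⁻¹' E = (s⁻¹ * ·) '' E := by
    rw [← Set.preimage_eq_iff_eq_image]
    · ext x; simp [hs.ne']
    · exact (mulLeft_bijective₀ _ (inv_ne_zero hs.ne'))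
  rw [Measure.map_apply hm hE, withDensity_apply _ (hm hE), withDensity_apply _ hE, himg,
    lintegral_image_eq_lintegral_abs_deriv_mul (f' := fun _ => s⁻¹) hE
      (fun x _ => by simpa using (hasDerivWithinAt_id x _).const_mul s⁻¹)
      (mul_right_injective₀ (inv_ne_zero hs.ne')).injOn, abs_of_pos (inv_pos.2 hs)]

namespace RandomCircuit

/-- The common part has the density min(p, q), whose mass is 1 minus the integral of the positive
part of p - q. With g(x) = x f(x) and r = 1/s, the identity f(x) - r f(rx) = (g(x) - g(rx))/x
reduces this integral to the dilation estimate. -/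
theorem HasDensityOfVariation.overlap {V : ℝ} {μ : Measure ℝ} (h : HasDensityOfVariation V μ)
    {s : ℝ} (hs : 0 < s) (hs1 : s < 1) :
    Overlap (1 - 2 * (ENNReal.ofReal V * ENNReal.ofReal (s⁻¹ - 1))) (μ.map (s * ·)) μ := by
  obtain ⟨hμ, f, hf, hf0, rfl, hV⟩ := h
  rw [map_mul_withDensity hs]
  have hr : 1 < s⁻¹ := (one_lt_inv₀ hs).2 hs1
  set r := s⁻¹
  set p : ℝ → ℝ≥0∞ := fun x => ENNReal.ofReal (f x) with hp
  set q : ℝ → ℝ≥0∞ := fun x => ENNReal.ofReal r * p (r * x) with hq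
  have hpm : Measurable p := by fun_prop
  have hqm : Measurable q := by fun_prop
  refine ⟨volume.withDensity fun x => min (p x) (q x),
    withDensity_mono (.of_forall fun x => min_le_right _ _),
    withDensity_mono (.of_forall fun x => min_le_left _ _), ?_⟩
  have h1 : ∫⁻ x, p x = 1 := by
    have := hμ.measure_univ
    rwa [withDensity_apply _ MeasurableSet.univ, setLIntegral_univ] at this
  have hdiff : ∫⁻ x, (p x - q x) ≤ 2 * (ENNReal.ofReal V * ENNReal.ofReal (r - 1)) := by
    have hae : ∀ᵐ x : ℝ, x ≠ 0 := by simp [ae_iff]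
    calc ∫⁻ x, (p x - q x)
        ≤ ∫⁻ x, edist (r * x * f (r * x)) (x * f x) * ENNReal.ofReal |x|⁻¹ := by
          refine lintegral_mono_ae ?_
          filter_upwards [hae] with x hx
          simp only [hp, hq]
          rw [← ENNReal.ofReal_mul (by positivity),
            ← ENNReal.ofReal_sub _ (mul_nonneg (by positivity) (hf0 _)), edist_dist,
            ← ENNReal.ofReal_mul dist_nonneg]
          refine ENNReal.ofReal_le_ofReal ?_
          rw [← div_eq_mul_inv, le_div_iff₀ (abs_pos.2 hx), Real.dist_eq, abs_sub_comm,
            show x * f x - r * x * f (r * x) = (f x - r * f (r * x)) * x by ring, abs_mul]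
          gcongr
          exact le_abs_self _
      _ ≤ 2 * (eVariationOn (fun x => x * f x) Set.univ * ENNReal.ofReal (r - 1)) :=
          lintegral_edist_mul_le (g := fun x => x * f x) (by fun_prop) hr
      _ ≤ _ := by gcongr
  rw [withDensity_apply _ MeasurableSet.univ, setLIntegral_univ]
  refine tsub_le_iff_right.2 ?_
  calc (1 : ℝ≥0∞) = ∫⁻ x, p x := h1.symm
    _ ≤ ∫⁻ x, (min (p x) (q x) + (p x - q x)) := by
        refine lintegral_mono fun x => ?_
        rcases le_total (p x) (q x) with h | h
        · simp [h]
        · simp [h, add_tsub_cancel_of_le]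
    _ = (∫⁻ x, min (p x) (q x)) + ∫⁻ x, (p x - q x) := lintegral_add_left (hpm.min hqm) _
    _ ≤ _ := add_le_add_right hdiff _

end RandomCircuit

/-! ### Frobenius distance of normal matrices -/

section Frobenius

attribute [local instance] Matrix.frobeniusNormedAddCommGroup Matrix.frobeniusNormedSpace

namespace Matrix

section

variable {n : Type*} [Fintype n]

theorem frobenius_norm_sq (A : Matrix n n ℂ) : ‖A‖ ^ 2 = ∑ i, ∑ j, ‖A i j‖ ^ 2 := by
  rw [frobenius_norm_def, ← Real.sqrt_eq_rpow, Real.sq_sqrt (by positivity)]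
  simp

theorem frobenius_norm_sq_eq_trace (A : Matrix n n ℂ) : ((‖A‖ ^ 2 : ℝ) : ℂ) = (Aᴴ * A).trace := by
  rw [frobenius_norm_sq, Finset.sum_comm]
  simp [trace, mul_apply, Complex.conj_mul']

end

variable {n : Type*} [Fintype n] [DecidableEq n]

theorem frobenius_norm_unitary_mul {U : Matrix n n ℂ} (hU : U ∈ unitaryGroup n ℂ)
    (A : Matrix n n ℂ) : ‖U * A‖ = ‖A‖ := by
  have h : ((‖U * A‖ ^ 2 : ℝ) : ℂ) = ((‖A‖ ^ 2 : ℝ) : ℂ) := by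
    rw [frobenius_norm_sq_eq_trace, frobenius_norm_sq_eq_trace, conjTranspose_mul, Matrix.mul_assoc,
      ← Matrix.mul_assoc Uᴴ, ← star_eq_conjTranspose U, mem_unitaryGroup_iff'.1 hU, Matrix.one_mul]
  exact (sq_eq_sq₀ (norm_nonneg _) (norm_nonneg _)).1 (Complex.ofReal_injective h)

theorem frobenius_norm_mul_unitary {U : Matrix n n ℂ} (hU : U ∈ unitaryGroup n ℂ)
    (A : Matrix n n ℂ) : ‖A * U‖ = ‖A‖ := by
  rw [← frobenius_norm_conjTranspose, conjTranspose_mul, ← star_eq_conjTranspose U,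
    frobenius_norm_unitary_mul (Unitary.star_mem hU), frobenius_norm_conjTranspose]

/-- The normal matrix `U diag(a) U⋆`. -/
def conjDiagonal (U : unitaryGroup n ℂ) (a : n → ℂ) : Matrix n n ℂ :=
  (U : Matrix n n ℂ) * diagonal a * star (U : Matrix n n ℂ)

/-- Multiplying by U⋆ on the left and W on the right preserves the norm and turns the (i, j) entry
into (a i - b j) (U⋆W) i j. -/
theorem frobenius_norm_conjDiagonal_sub_sq (U W : unitaryGroup n ℂ) (a b : n → ℂ) :
    ‖conjDiagonal U a - conjDiagonal W b‖ ^ 2 =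
      ∑ i, ∑ j, (‖a i - b j‖ * ‖(star (U : Matrix n n ℂ) * W) i j‖) ^ 2 := by
  have hU : star (U : Matrix n n ℂ) * U = 1 := mem_unitaryGroup_iff'.1 U.2
  have hW : star (W : Matrix n n ℂ) * W = 1 := mem_unitaryGroup_iff'.1 W.2
  have key : star (U : Matrix n n ℂ) * (conjDiagonal U a - conjDiagonal W b) * W =
      diagonal a * (star (U : Matrix n n ℂ) * W) - (star (U : Matrix n n ℂ) * W) * diagonal b := by
    simp only [conjDiagonal, Matrix.mul_sub, Matrix.sub_mul, Matrix.mul_assoc, hW, Matrix.mul_one]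
    rw [← Matrix.mul_assoc (star _) (U : Matrix n n ℂ), hU, Matrix.one_mul]
  rw [← frobenius_norm_unitary_mul (Unitary.star_mem U.2), ← frobenius_norm_mul_unitary W.2, key,
    frobenius_norm_sq]
  refine Finset.sum_congr rfl fun i _ => Finset.sum_congr rfl fun j _ => ?_
  rw [sub_apply, diagonal_mul, mul_diagonal, mul_comm _ (b j), ← sub_mul, norm_mul]

/-- The weights |(U⋆W) i j|² do not depend on the eigenvalues, so a scalar inequality for all pairs
of eigenvalues passes to matrices that need not commute. -/
theorem frobenius_norm_conjDiagonal_sub_le {U W : unitaryGroup n ℂ} {a b a' b' : n → ℂ} {K : ℝ}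
    (hK : 0 ≤ K) (h : ∀ i j, ‖a i - b j‖ ≤ K * ‖a' i - b' j‖) :
    ‖conjDiagonal U a - conjDiagonal W b‖ ≤ K * ‖conjDiagonal U a' - conjDiagonal W b'‖ := by
  refine (sq_le_sq₀ (norm_nonneg _) (by positivity)).1 ?_
  rw [mul_pow, frobenius_norm_conjDiagonal_sub_sq, frobenius_norm_conjDiagonal_sub_sq,
    Finset.mul_sum]
  refine Finset.sum_le_sum fun i _ => ?_
  rw [Finset.mul_sum]
  refine Finset.sum_le_sum fun j _ => ?_
  rw [← mul_pow, ← mul_assoc]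
  gcongr
  exact h i j

theorem frobenius_norm_conjDiagonal_sq (U : unitaryGroup n ℂ) (a : n → ℂ) :
    ‖conjDiagonal U a‖ ^ 2 = ∑ i, ‖a i‖ ^ 2 := by
  rw [conjDiagonal, frobenius_norm_mul_unitary (Unitary.star_mem U.2), frobenius_norm_unitary_mul U.2,
    frobenius_norm_diagonal, EuclideanSpace.norm_sq_eq]

theorem exp_conjDiagonal (U : unitaryGroup n ℂ) (a : n → ℂ) :
    NormedSpace.exp (conjDiagonal U a) = conjDiagonal U fun i => Complex.exp (a i) := by
  have hinv : star (U : Matrix n n ℂ) = (U : Matrix n n ℂ)⁻¹ :=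
    (inv_eq_left_inv (mem_unitaryGroup_iff'.1 U.2)).symm
  have hunit : IsUnit (U : Matrix n n ℂ) :=
    .of_mul_eq_one _ (mem_unitaryGroup_iff.1 U.2)
  rw [conjDiagonal, hinv, exp_conj _ _ hunit, exp_diagonal, conjDiagonal, hinv]
  congr 3
  ext i
  rw [Pi.exp_def, Complex.exp_eq_exp_ℂ]

theorem smul_conjDiagonal (c : ℂ) (U : unitaryGroup n ℂ) (a : n → ℂ) :
    c • conjDiagonal U a = conjDiagonal U fun i => c * a i := by
  rw [conjDiagonal, conjDiagonal, ← Matrix.smul_mul, ← Matrix.mul_smul, ← diagonal_smul]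
  rfl

theorem conjDiagonal_mul (U : unitaryGroup n ℂ) (a b : n → ℂ) :
    conjDiagonal U a * conjDiagonal U b = conjDiagonal U fun i => a i * b i := by
  have hU : star (U : Matrix n n ℂ) * U = 1 := mem_unitaryGroup_iff'.1 U.2
  simp only [conjDiagonal, Matrix.mul_assoc]
  rw [← Matrix.mul_assoc (star _) (U : Matrix n n ℂ), hU, Matrix.one_mul,
    ← Matrix.mul_assoc (diagonal a), diagonal_mul_diagonal]

theorem IsHermitian.eq_conjDiagonal {A : Matrix n n ℂ} (hA : A.IsHermitian) :
    A = conjDiagonal hA.eigenvectorUnitary fun i => (hA.eigenvalues i : ℂ) := by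
  conv_lhs => rw [hA.spectral_theorem]
  rfl

end Matrix

end Frobenius

/-! ### Chords of the unit circle -/

open Complex in
theorem norm_exp_I_mul_sub (a b : ℝ) :
    ‖exp (I * a) - exp (I * b)‖ = 2 * |Real.sin ((a - b) / 2)| := by
  have : exp (I * a) - exp (I * b) = exp (I * b) * (exp (I * ((a - b : ℝ) : ℂ)) - 1) := by
    rw [mul_sub, ← exp_add, mul_one]
    congr 2
    push_cast; ring
  rw [this, norm_mul, norm_exp_I_mul_ofReal, one_mul, norm_exp_I_mul_ofReal_sub_one, norm_mul]
  simp

theorem abs_sin_eq_abs_sin_abs (x : ℝ) : |Real.sin x| = |Real.sin (abs x)| := by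
  rcases abs_choice x with h | h <;> simp [h]

/-- This is concavity of the sine on [0, π] between 0 and |x|, together with sin 0 = 0. -/
theorem mul_abs_sin_le_abs_sin_mul {s x : ℝ} (hs : 0 ≤ s) (hs1 : s ≤ 1) (hx : |x| ≤ Real.pi) :
    s * |Real.sin x| ≤ |Real.sin (s * x)| := by
  have h0 : 0 ≤ |x| := abs_nonneg x
  have h1 : s * |x| ≤ Real.pi := by nlinarith
  have h2 : s * Real.sin |x| ≤ Real.sin (s * |x|) := by
    have := strictConcaveOn_sin_Icc.concaveOn.2 ⟨h0, hx⟩ ⟨le_rfl, Real.pi_pos.le⟩ hs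
      (sub_nonneg.2 hs1) (by ring)
    simpa using this
  rw [abs_sin_eq_abs_sin_abs x, abs_sin_eq_abs_sin_abs (s * x), abs_mul, abs_of_nonneg hs,
    abs_of_nonneg (Real.sin_nonneg_of_nonneg_of_le_pi h0 hx)]
  exact h2.trans (le_abs_self _)

/-! ### Hermitian logarithms and real powers of gates -/

namespace RandomCircuit

section

variable {σ : Type} [Fintype σ] [DecidableEq σ]

instance secondCountableTopology_gate : SecondCountableTopology (Gate σ) :=
  have : SecondCountableTopology (Matrix (Basis σ) (Basis σ) ℂ) :=
    inferInstanceAs (SecondCountableTopology (Basis σ → Basis σ → ℂ))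
  TopologicalSpace.Subtype.secondCountableTopology _

/-- The gate with the eigenvectors `U |k⟩` and the eigenvalues `e^{i φ k}`. -/
noncomputable def phaseGate (U : Gate σ) (φ : Basis σ → ℝ) : Gate σ := U * zGate φ * star U

theorem coe_phaseGate (U : Gate σ) (φ : Basis σ → ℝ) :
    (phaseGate U φ : Matrix (Basis σ) (Basis σ) ℂ) =
      Matrix.conjDiagonal U fun k => Complex.exp (Complex.I * φ k) := rfl

theorem phaseGate_mul (U : Gate σ) (φ ψ : Basis σ → ℝ) :
    phaseGate U φ * phaseGate U ψ = phaseGate U (φ + ψ) := by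
  ext1
  rw [Submonoid.coe_mul, coe_phaseGate, coe_phaseGate, coe_phaseGate, Matrix.conjDiagonal_mul]
  congr 1
  funext k
  rw [← Complex.exp_add, Pi.add_apply]
  push_cast
  ring_nf

end

/-- The space of Hermitian matrices. -/
def Herm (σ : Type) : Type := selfAdjoint.submodule ℝ (Matrix (Basis σ) (Basis σ) ℂ)

namespace Herm

section

variable {σ : Type}

/-- A Hermitian matrix, as a matrix. -/
def toMatrix (X : Herm σ) : Matrix (Basis σ) (Basis σ) ℂ := Subtype.val X

theorem isHermitian (X : Herm σ) : X.toMatrix.IsHermitian := Subtype.property X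

section Frobenius

variable [Fintype σ] [DecidableEq σ]

attribute [local instance] Matrix.frobeniusNormedAddCommGroup Matrix.frobeniusNormedSpace

noncomputable instance : NormedAddCommGroup (Herm σ) :=
  inferInstanceAs (NormedAddCommGroup (selfAdjoint.submodule ℝ (Matrix (Basis σ) (Basis σ) ℂ)))

noncomputable instance : NormedSpace ℝ (Herm σ) :=
  inferInstanceAs (NormedSpace ℝ (selfAdjoint.submodule ℝ (Matrix (Basis σ) (Basis σ) ℂ)))

instance : FiniteDimensional ℝ (Herm σ) :=
  inferInstanceAs (FiniteDimensional ℝ (selfAdjoint.submodule ℝ (Matrix (Basis σ) (Basis σ) ℂ)))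

theorem norm_eq (X : Herm σ) : ‖X‖ = ‖X.toMatrix‖ := rfl

theorem dist_eq (X Y : Herm σ) : dist X Y = ‖X.toMatrix - Y.toMatrix‖ := dist_eq_norm X Y

theorem norm_sq (X : Herm σ) : ‖X‖ ^ 2 = ∑ k, X.isHermitian.eigenvalues k ^ 2 := by
  have := Matrix.frobenius_norm_conjDiagonal_sq X.isHermitian.eigenvectorUnitary
    fun k => (X.isHermitian.eigenvalues k : ℂ)
  rw [← X.isHermitian.eq_conjDiagonal] at this
  simpa [norm_eq] using this

end Frobenius

end

variable (σ : Type) [Fintype σ] [DecidableEq σ]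

/-- The real dimension of all complex matrices is a crude bound, but any bound depending only on the
gate dimension suffices. -/
theorem finrank_le : Module.finrank ℝ (Herm σ) ≤ 2 * Fintype.card (Basis σ) ^ 2 := by
  refine (Submodule.finrank_le (selfAdjoint.submodule ℝ (Matrix (Basis σ) (Basis σ) ℂ))).trans ?_
  rw [finrank_real_of_complex, Module.finrank_matrix]
  simp [sq]

end Herm

variable {σ : Type} [Fintype σ] [DecidableEq σ]

/-- The gate `exp (i X)`. -/
noncomputable def hermExp (X : Herm σ) : Gate σ :=
  phaseGate X.isHermitian.eigenvectorUnitary X.isHermitian.eigenvalues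

section CFC

open scoped Matrix.Norms.L2Operator

theorem isStarNormal_gate (H : Gate σ) : IsStarNormal (H : Matrix (Basis σ) (Basis σ) ℂ) :=
  isStarNormal_of_mem_unitary H.2

theorem norm_eq_one_of_mem_spectrum_gate (H : Gate σ) {z : ℂ}
    (hz : z ∈ spectrum ℂ (H : Matrix (Basis σ) (Basis σ) ℂ)) : ‖z‖ = 1 := by
  simpa using spectrum.subset_circle_of_unitary H.2 hz

theorem coe_gatePow (H : Gate σ) (t : ℝ) :
    (gatePow H t : Matrix (Basis σ) (Basis σ) ℂ) =
      cfc (fun z => Complex.exp (t * Complex.log z)) (H : Matrix (Basis σ) (Basis σ) ℂ) := by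
  have hH := isStarNormal_gate H
  have hc (f : ℂ → ℂ) := (H : Matrix (Basis σ) (Basis σ) ℂ).finite_spectrum.continuousOn f
  have h1 : (t : ℝ) • gateLog H =
      cfc (fun z => t * Complex.log z) (H : Matrix (Basis σ) (Basis σ) ℂ) := by
    rw [cfc_const_mul _ _ _ (hc _), gateLog, Complex.coe_smul]
  change NormedSpace.exp (t • gateLog H) = _
  rw [h1, ← CFC.complex_exp_eq_normedSpace_exp (cfc_predicate _ _),
    ← cfc_comp' _ _ _ (by fun_prop) (hc _)]

theorem gatePow_zero (H : Gate σ) : gatePow H 0 = 1 := by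
  refine Subtype.ext ?_
  change NormedSpace.exp ((0 : ℝ) • gateLog H) = 1
  rw [zero_smul, NormedSpace.exp_zero]

theorem gatePow_one (H : Gate σ) : gatePow H 1 = H := by
  refine Subtype.ext ?_
  rw [coe_gatePow]
  refine (cfc_congr (g := id) fun z hz => ?_).trans (cfc_id ℂ _ (isStarNormal_gate H))
  have hz0 : z ≠ 0 := norm_ne_zero_iff.1 (by simp [norm_eq_one_of_mem_spectrum_gate H hz])
  simp [Complex.exp_log hz0]

/-- Every gate is the exponential of `i` times a Hermitian matrix with eigenvalues in `(-π, π]`. -/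
theorem exists_log (H : Gate σ) : ∃ X : Herm σ,
    (∀ k, X.isHermitian.eigenvalues k ∈ Set.Ioc (-Real.pi) Real.pi) ∧ hermExp X = H ∧
      ∀ t : ℝ, gatePow H t =
        phaseGate X.isHermitian.eigenvectorUnitary (t • X.isHermitian.eigenvalues) := by
  have hH := isStarNormal_gate H
  have hc (f : ℂ → ℂ) := (H : Matrix (Basis σ) (Basis σ) ℂ).finite_spectrum.continuousOn f
  have hX : IsSelfAdjoint (-Complex.I • gateLog H) := by
    rw [IsSelfAdjoint, star_smul, star_gateLog]
    simp
  let X : Herm σ := (⟨-Complex.I • gateLog H, hX⟩ : selfAdjoint.submodule ℝ _)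
  have hXm : X.toMatrix = -Complex.I • gateLog H := rfl
  have hlog : gateLog H = Matrix.conjDiagonal X.isHermitian.eigenvectorUnitary
      fun k => Complex.I * X.isHermitian.eigenvalues k := by
    rw [← Matrix.smul_conjDiagonal, ← X.isHermitian.eq_conjDiagonal, hXm, smul_smul]
    simp
  have hpow (t : ℝ) : gatePow H t =
      phaseGate X.isHermitian.eigenvectorUnitary (t • X.isHermitian.eigenvalues) := by
    refine Subtype.ext ?_
    change NormedSpace.exp (t • gateLog H) = _
    rw [hlog, coe_phaseGate, ← Complex.coe_smul, Matrix.smul_conjDiagonal,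
      Matrix.exp_conjDiagonal]
    congr 1
    funext k
    rw [mul_left_comm, Pi.smul_apply, smul_eq_mul, Complex.ofReal_mul]
  refine ⟨X, fun k => ?_, ?_, hpow⟩
  · have hk : (X.isHermitian.eigenvalues k : ℂ) ∈ spectrum ℂ X.toMatrix := by
      rw [X.isHermitian.spectrum_eq_image_range]
      exact ⟨_, ⟨k, rfl⟩, rfl⟩
    have hspec : spectrum ℂ X.toMatrix = (fun z => -Complex.I * Complex.log z) ''
        spectrum ℂ (H : Matrix (Basis σ) (Basis σ) ℂ) := by
      rw [hXm, gateLog, ← cfc_const_mul _ _ _ (hc _), cfc_map_spectrum _ _ hH (hc _)]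
    rw [hspec] at hk
    obtain ⟨z, -, hz⟩ := hk
    have : X.isHermitian.eigenvalues k = z.arg := by
      simpa [Complex.log_im] using (congrArg Complex.re hz).symm
    rw [this]
    exact Complex.arg_mem_Ioc z
  · rw [← gatePow_one H, hpow, one_smul, hermExp]

/-- The power is discontinuous where -1 is an eigenvalue. It is a pointwise limit of continuous
functional calculi: `f k` agrees with `g` away from a shrinking neighbourhood of -1 and at -1
itself. As a spectrum is finite, `f k` eventually equals `g` on it. -/
theorem measurable_gatePow (t : ℝ) : Measurable fun H : Gate σ => gatePow H t := by
  borelize (Matrix (Basis σ) (Basis σ) ℂ)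
  have hemb : Topology.IsClosedEmbedding
      (Subtype.val : Gate σ → Matrix (Basis σ) (Basis σ) ℂ) :=
    IsClosed.isClosedEmbedding_subtypeVal isClosed_unitary
  rw [← hemb.measurableEmbedding.measurable_comp_iff]
  set g : ℂ → ℂ := fun z => Complex.exp (t * Complex.log z) with hg
  let w : ℕ → ℂ → ℝ := fun k z => min 1 (k * ‖z + 1‖)
  let f : ℕ → ℂ → ℂ := fun k z => g (-1) + w k z * (g z - g (-1))
  have hgn {z : ℂ} (hz : ‖z‖ = 1) : ‖g z‖ = 1 := by
    simp [hg, Complex.norm_exp, Complex.log_re, hz]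
  have hf (k : ℕ) : ContinuousOn (f k) (Metric.sphere 0 1) := by
    intro z hz
    have hz1 : ‖z‖ = 1 := mem_sphere_zero_iff_norm.1 hz
    refine ContinuousWithinAt.add continuousWithinAt_const ?_
    have hw : Continuous fun z => (w k z : ℂ) := by fun_prop
    -- At -1 the weight tends to 0 while the other factor stays bounded by 2. Every other point of
    -- the circle lies in the slit plane, where the logarithm is continuous.
    by_cases hz' : z = -1
    · subst hz'
      have h0 : (w k (-1) : ℂ) * (g (-1) - g (-1)) = 0 := by simp
      rw [ContinuousWithinAt, h0]
      have hw0 : Filter.Tendsto (fun z => (w k z : ℂ)) (nhdsWithin (-1) (Metric.sphere 0 1))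
          (nhds 0) := by
        have := (hw.tendsto (-1)).mono_left (nhdsWithin_le_nhds (s := Metric.sphere 0 1))
        simpa [w] using this
      refine hw0.zero_mul_isBoundedUnder_le ⟨2, ?_⟩
      rw [Filter.eventually_map]
      filter_upwards [self_mem_nhdsWithin] with y hy
      have hy1 := hgn (mem_sphere_zero_iff_norm.1 hy)
      have hm1 := hgn hz1
      exact (norm_sub_le _ _).trans (by rw [hy1, hm1]; norm_num)
    · have hsl : z ∈ Complex.slitPlane := by
        by_contra h
        rw [Complex.mem_slitPlane_iff, not_or, not_lt, not_not] at h
        refine hz' (Complex.ext ?_ (by simpa using h.2))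
        have h2 : z.re ^ 2 = 1 := by
          have := Complex.sq_norm z
          rw [Complex.normSq_apply, h.2, hz1] at this
          linarith
        rcases mul_self_eq_one_iff.1 ((sq _).symm.trans h2) with h3 | h3
        all_goals simp; linarith [h.1]
      have : ContinuousAt (fun z => (w k z : ℂ) * (g z - g (-1))) z := by
        refine hw.continuousAt.mul (ContinuousAt.sub ?_ continuousAt_const)
        exact (continuousAt_const.mul (continuousAt_clog hsl)).cexp
      exact this.continuousWithinAt
  have hlim : Filter.Tendsto
      (fun k (H : Gate σ) => cfc (f k) (H : Matrix (Basis σ) (Basis σ) ℂ)) Filter.atTop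
      (nhds fun H => (gatePow H t : Matrix (Basis σ) (Basis σ) ℂ)) := by
    refine tendsto_pi_nhds.2 fun H => tendsto_const_nhds.congr' ?_
    have hev : ∀ᶠ k : ℕ in Filter.atTop,
        ∀ z ∈ spectrum ℂ (H : Matrix (Basis σ) (Basis σ) ℂ), g z = f k z := by
      refine (Set.Finite.eventually_all (Matrix.finite_spectrum _)).2 fun z _ => ?_
      by_cases hz : z = -1
      · exact .of_forall fun k => by simp [f, hz]
      · have hpos : 0 < ‖z + 1‖ := norm_pos_iff.2 fun h => hz (eq_neg_of_add_eq_zero_left h)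
        obtain ⟨K, hK⟩ := exists_nat_ge (1 / ‖z + 1‖)
        filter_upwards [Filter.eventually_ge_atTop K] with k hk
        have h1 : 1 ≤ k * ‖z + 1‖ := by
          rw [← div_le_iff₀ hpos]
          exact hK.trans (by exact_mod_cast hk)
        simp [f, w, h1]
    filter_upwards [hev] with k hk
    rw [coe_gatePow]
    exact cfc_congr hk
  refine measurable_of_tendsto_metrizable (fun k => Continuous.measurable ?_) hlim
  exact Continuous.cfc' (isCompact_sphere 0 1) (f k) continuous_subtype_val
    (fun H z hz => mem_sphere_zero_iff_norm.2 (norm_eq_one_of_mem_spectrum_gate H hz)) (hf k)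
    isStarNormal_gate

end CFC

theorem mul_gatePow_neg (H : Gate σ) (t : ℝ) : H * gatePow H (-t) = gatePow H (1 - t) := by
  obtain ⟨X, -, h1, h2⟩ := exists_log H
  rw [h2, h2]
  conv_lhs => rw [← h1]
  rw [hermExp, phaseGate_mul, sub_smul, one_smul, neg_smul, ← sub_eq_add_neg]

end RandomCircuit

/-! ### Haar measure as a Hausdorff measure -/

namespace RandomCircuit

section Metric

variable {σ : Type} [Fintype σ] [DecidableEq σ]

/-- The metric of the Frobenius norm on the unitary group. -/
@[reducible] noncomputable def gateMetricSpace : MetricSpace (Gate σ) :=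
  letI := Matrix.frobeniusNormedAddCommGroup (m := Basis σ) (n := Basis σ) (α := ℂ)
  letI : MetricSpace (Gate σ) := Subtype.metricSpace
  -- The topology, and with it the Borel structure, stays definitionally unchanged.
  this.replaceTopology rfl

attribute [local instance] gateMetricSpace

theorem dist_gate (U W : Gate σ) :
    dist U W = @norm _ Matrix.frobeniusNormedAddCommGroup.toNorm
      ((U : Matrix (Basis σ) (Basis σ) ℂ) - (W : Matrix (Basis σ) (Basis σ) ℂ)) :=
  @dist_eq_norm _ Matrix.frobeniusNormedAddCommGroup.toSeminormedAddCommGroup _ _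

theorem isometry_gate_mul_left (U : Gate σ) : Isometry (U * ·) := by
  refine Isometry.of_dist_eq fun V W => ?_
  rw [dist_gate, dist_gate, Submonoid.coe_mul, Submonoid.coe_mul, ← Matrix.mul_sub,
    Matrix.frobenius_norm_unitary_mul U.2]

instance isMulLeftInvariant_hausdorffMeasure (D : ℝ) :
    (μH[D] : Measure (Gate σ)).IsMulLeftInvariant := by
  refine ⟨fun U => ?_⟩
  have hs : Function.Surjective (U * ·) := mul_left_surjective U
  rw [(isometry_gate_mul_left U).map_hausdorffMeasure (.inr hs), hs.range_eq,
    Measure.restrict_univ]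

/-- The half-difference of two angles in (-π, π] lies in (-π, π), exactly the range in which
contraction by s shrinks |sin| by no more than the factor s. -/
theorem dist_phaseGate_smul {s : ℝ} (hs : 0 < s) (hs1 : s ≤ 1) {U W : Gate σ}
    {φ ψ : Basis σ → ℝ} (hφ : ∀ k, φ k ∈ Set.Ioc (-Real.pi) Real.pi)
    (hψ : ∀ k, ψ k ∈ Set.Ioc (-Real.pi) Real.pi) :
    dist (phaseGate U φ) (phaseGate W ψ) ≤
      s⁻¹ * dist (phaseGate U (s • φ)) (phaseGate W (s • ψ)) := by
  rw [dist_gate, dist_gate]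
  refine Matrix.frobenius_norm_conjDiagonal_sub_le (inv_nonneg.2 hs.le) fun i j => ?_
  rw [norm_exp_I_mul_sub, norm_exp_I_mul_sub, le_inv_mul_iff₀ hs]
  have := mul_abs_sin_le_abs_sin_mul hs.le hs1 (x := (φ i - ψ j) / 2) (abs_le.2
    ⟨by linarith [(hφ i).1, (hψ j).2], by linarith [(hφ i).2, (hψ j).1]⟩)
  have e : ((s • φ) i - (s • ψ) j) / 2 = s * ((φ i - ψ j) / 2) := by simp; ring
  rw [e]
  linarith

theorem lipschitzWith_hermExp : LipschitzWith 1 (hermExp (σ := σ)) := by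
  refine LipschitzWith.of_dist_le_mul fun X Y => ?_
  rw [dist_gate, Herm.dist_eq]
  conv_rhs => rw [X.isHermitian.eq_conjDiagonal, Y.isHermitian.eq_conjDiagonal]
  refine Matrix.frobenius_norm_conjDiagonal_sub_le zero_le_one fun i j => ?_
  rw [norm_exp_I_mul_sub, ← Complex.ofReal_sub, Complex.norm_real, Real.norm_eq_abs]
  have := Real.abs_sin_le_abs (x := (X.isHermitian.eigenvalues i - Y.isHermitian.eigenvalues j) / 2)
  rw [abs_div, abs_two] at this
  rw [NNReal.coe_one, one_mul]
  linarith

/-- In the unit ball the eigenvalues lie in [-1, 1], so half-differences are below π/2 and Jordan's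
inequality sin x ≥ 2x/π applies. -/
theorem dist_le_dist_hermExp {X Y : Herm σ} (hX : ‖X‖ ≤ 1) (hY : ‖Y‖ ≤ 1) :
    dist X Y ≤ Real.pi / 2 * dist (hermExp X) (hermExp Y) := by
  have hev {Z : Herm σ} (hZ : ‖Z‖ ≤ 1) (k : Basis σ) : |Z.isHermitian.eigenvalues k| ≤ 1 := by
    rw [← sq_le_one_iff_abs_le_one]
    calc _ ≤ ∑ k, Z.isHermitian.eigenvalues k ^ 2 :=
          Finset.single_le_sum (f := fun k => Z.isHermitian.eigenvalues k ^ 2)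
            (fun _ _ => sq_nonneg _) (Finset.mem_univ k)
      _ = ‖Z‖ ^ 2 := Z.norm_sq.symm
      _ ≤ 1 := pow_le_one₀ (norm_nonneg _) hZ
  rw [dist_gate, Herm.dist_eq]
  conv_lhs => rw [X.isHermitian.eq_conjDiagonal, Y.isHermitian.eq_conjDiagonal]
  refine Matrix.frobenius_norm_conjDiagonal_sub_le (by positivity) fun i j => ?_
  rw [norm_exp_I_mul_sub, ← Complex.ofReal_sub, Complex.norm_real, Real.norm_eq_abs]
  set d := X.isHermitian.eigenvalues i - Y.isHermitian.eigenvalues j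
  have hd : |d| ≤ 2 := (abs_sub _ _).trans (by linarith [hev hX i, hev hY j])
  have h1 : 2 / Real.pi * |d / 2| ≤ |Real.sin (d / 2)| := by
    rw [abs_sin_eq_abs_sin_abs]
    refine (Real.mul_le_sin (abs_nonneg _) ?_).trans (le_abs_self _)
    rw [abs_div, abs_two]
    linarith [Real.pi_gt_three]
  have h2 : |d| = Real.pi / 2 * (2 * (2 / Real.pi * |d / 2|)) := by
    rw [abs_div, abs_two]; field_simp
  rw [h2]
  gcongr

/-- The jump of the logarithm is harmless here: it only separates points, while the bound needed is
one from below on distances. -/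
theorem antilipschitzWith_gatePow {s : ℝ} (hs : 0 < s) (hs1 : s ≤ 1) :
    AntilipschitzWith (Real.toNNReal s⁻¹) fun H : Gate σ => gatePow H s := by
  refine AntilipschitzWith.of_le_mul_dist fun H H' => ?_
  obtain ⟨X, hX, h1, h2⟩ := exists_log H
  obtain ⟨X', hX', h1', h2'⟩ := exists_log H'
  rw [h2, h2', Real.coe_toNNReal _ (inv_nonneg.2 hs.le)]
  conv_lhs => rw [← h1, ← h1']
  exact dist_phaseGate_smul hs hs1 hX hX'

section Haar

variable (σ)

/-- All gates are exponentials of Hermitian matrices in a ball of finite measure, and the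
exponential is 1-Lipschitz. The radius comes from d eigenvalues of modulus at most π. -/
theorem hausdorffMeasure_gate_lt_top :
    (μH[Module.finrank ℝ (Herm σ)] : Measure (Gate σ)) Set.univ < ∞ := by
  borelize (Herm σ)
  set R : ℝ := √(Fintype.card (Basis σ) * Real.pi ^ 2)
  have hsub : (Set.univ : Set (Gate σ)) ⊆ hermExp '' Metric.closedBall 0 R := by
    intro H _
    obtain ⟨X, hX, h1, -⟩ := exists_log H
    refine ⟨X, ?_, h1⟩
    rw [mem_closedBall_zero_iff]
    refine Real.le_sqrt_of_sq_le ?_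
    rw [X.norm_sq, ← nsmul_eq_mul]
    refine Finset.sum_le_card_nsmul _ _ _ fun k _ => sq_le_sq' (hX k).1.le (hX k).2
  refine (measure_mono hsub).trans_lt ((lipschitzWith_hermExp.hausdorffMeasure_image_le
    (Nat.cast_nonneg _) _).trans_lt ?_)
  simp [measure_closedBall_lt_top]

/-- The exponential of the unit ball is antilipschitz, so it cannot crush a set of positive measure
to a null set. -/
theorem hausdorffMeasure_gate_ne_zero :
    (μH[Module.finrank ℝ (Herm σ)] : Measure (Gate σ)) Set.univ ≠ 0 := by
  borelize (Herm σ)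
  have hD : (0 : ℝ) ≤ Module.finrank ℝ (Herm σ) := Nat.cast_nonneg _
  have hanti : AntilipschitzWith (Real.pi / 2).toNNReal
      fun X : Metric.closedBall (0 : Herm σ) 1 => hermExp X.1 := by
    refine AntilipschitzWith.of_le_mul_dist fun X Y => ?_
    rw [Real.coe_toNNReal _ (by positivity)]
    exact dist_le_dist_hermExp (mem_closedBall_zero_iff.1 X.2) (mem_closedBall_zero_iff.1 Y.2)
  intro h0
  have h1 := hanti.le_hausdorffMeasure_image hD Set.univ
  rw [measure_mono_null (Set.subset_univ _) h0, mul_zero, nonpos_iff_eq_zero] at h1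
  have h2 := isometry_subtype_coe.hausdorffMeasure_image (X := Metric.closedBall (0 : Herm σ) 1)
    (.inl hD) Set.univ
  rw [h1, Set.image_univ, Subtype.range_coe] at h2
  exact (Metric.measure_closedBall_pos (μH[Module.finrank ℝ (Herm σ)]) (0 : Herm σ) one_pos).ne' h2

theorem hausdorffMeasure_gate_eq :
    (μH[Module.finrank ℝ (Herm σ)] : Measure (Gate σ)) =
      (μH[Module.finrank ℝ (Herm σ)] : Measure (Gate σ)) Set.univ • haarGate σ := by
  have : IsFiniteMeasure (μH[Module.finrank ℝ (Herm σ)] : Measure (Gate σ)) :=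
    ⟨hausdorffMeasure_gate_lt_top σ⟩
  exact Measure.haarMeasure_unique _ ⊤

end Haar

theorem haarGate_preimage_gatePow_le {s : ℝ} (hs : 0 < s) (hs1 : s ≤ 1) (E : Set (Gate σ)) :
    haarGate σ ((fun H => gatePow H s) ⁻¹' E) ≤
      ENNReal.ofReal s⁻¹ ^ Module.finrank ℝ (Herm σ) * haarGate σ E := by
  have h := (antilipschitzWith_gatePow (σ := σ) hs hs1).hausdorffMeasure_preimage_le
    (d := Module.finrank ℝ (Herm σ)) (Nat.cast_nonneg _) E
  rw [hausdorffMeasure_gate_eq, Measure.smul_apply, Measure.smul_apply, smul_eq_mul, smul_eq_mul,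
    mul_left_comm, ENNReal.rpow_natCast] at h
  exact (ENNReal.mul_le_mul_iff_right (hausdorffMeasure_gate_ne_zero σ)
    (hausdorffMeasure_gate_lt_top σ).ne).1 h

instance isProbabilityMeasure_haarGate : IsProbabilityMeasure (haarGate σ) :=
  ⟨Measure.haarMeasure_self⟩

theorem overlap_haarGate {s : ℝ} (hs : 0 < s) (hs1 : s ≤ 1) :
    Overlap (ENNReal.ofReal s ^ (2 * Fintype.card (Basis σ) ^ 2))
      ((haarGate σ).map fun H => gatePow H s) (haarGate σ) := by
  have hc : ENNReal.ofReal s ≤ 1 := by simpa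
  have : IsProbabilityMeasure ((haarGate σ).map fun H => gatePow H s) :=
    Measure.isProbabilityMeasure_map (measurable_gatePow s).aemeasurable
  refine (Overlap.of_smul_le (c := ENNReal.ofReal s ^ Module.finrank ℝ (Herm σ))
    (pow_le_one₀ zero_le hc) (Measure.le_iff.2 fun E hE => ?_)).mono
    (pow_le_pow_of_le_one zero_le hc (Herm.finrank_le σ))
  rw [Measure.smul_apply, Measure.map_apply (measurable_gatePow s) hE, smul_eq_mul]
  calc _ ≤ _ := mul_le_mul_right (haarGate_preimage_gatePow_le hs hs1 E) _
    _ = haarGate σ E := by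
      rw [← mul_assoc, ← mul_pow, ← ENNReal.ofReal_mul hs.le, mul_inv_cancel₀ hs.ne']
      simp

end Metric

end RandomCircuit

namespace RandomCircuit

/-! ### Dimensions and constants -/

theorem Location.card_support_le {n : ℕ} {Γ : SimpleGraph (Fin n)} (l : Location Γ) :
    l.support.card ≤ 2 := by
  cases l with
  | vertex v => simp [Location.support]
  | edge e =>
    rw [Location.support, Sym2.card_toFinset]
    split_ifs <;> simp

theorem Architecture.card_basis_supp_le {n : ℕ} (A : Architecture n) (j : Fin A.size) :
    Fintype.card (Basis (A.supp j)) ≤ 4 := by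
  rw [Fintype.card_fun, Fintype.card_fin, Fintype.card_coe]
  exact Nat.pow_le_pow_right two_pos (Location.card_support_le _)

theorem div_natCast_le_self {θ : ℝ} (hθ : 0 ≤ θ) (m : ℕ) : θ / m ≤ θ := by
  rcases m.eq_zero_or_pos with rfl | hm
  · simpa using hθ
  · exact div_le_self hθ (by exact_mod_cast hm)

/-- Bernoulli's inequality gives (1 - θ/m)^(km) ≥ 1 - kθ, which removes the dependence on the number
of gates. -/
theorem tvDist_le_of_overlap_pow {α : Type} [MeasurableSpace α] {μ ν : Measure α}
    [IsProbabilityMeasure μ] [IsProbabilityMeasure ν] {θ : ℝ} {k m : ℕ} (hθ : 0 ≤ θ) (hθ1 : θ ≤ 1)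
    (h : Overlap (ENNReal.ofReal (1 - θ / m) ^ (k * m)) μ ν) : tvDist μ ν ≤ k * θ := by
  have ht0 : 0 ≤ θ / m := by positivity
  have ht1 : θ / m ≤ 1 := (div_natCast_le_self hθ m).trans hθ1
  have hm : m * (θ / m) ≤ θ := by
    rcases m.eq_zero_or_pos with rfl | hm
    · simpa using hθ
    · exact (mul_div_cancel₀ θ (by positivity)).le
  have h1 := one_add_mul_le_pow (a := -(θ / m)) (by linarith) (k * m)
  rw [← sub_eq_add_neg 1] at h1
  rw [← ENNReal.ofReal_pow (by linarith)] at h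
  refine (tvDist_le_of_overlap h).trans ?_
  push_cast at h1
  nlinarith [mul_le_mul_of_nonneg_left hm (Nat.cast_nonneg (α := ℝ) k)]

/-! ### Haar random circuits -/

section Haar

variable {n : ℕ} {A : Architecture n}

theorem measurable_mul_gates (G : A.Circuit) :
    Measurable fun (H : A.Circuit) (j : Fin A.size) => H j * G j :=
  measurable_pi_lambda _ fun j =>
    (measurable_mul_const (G j)).comp (measurable_pi_apply (X := fun j => Gate (A.supp j)) j)

theorem haarInterp_eq (G : A.Circuit) (θ : ℝ) :
    haarInterp G θ = (fun H j => H j * G j) ∘ fun H j => gatePow (H j) (1 - θ / A.size) := by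
  funext H j
  rw [haarInterp, mul_gatePow_neg, Function.comp]

theorem haarInterp_size (G H : A.Circuit) : haarInterp G A.size H = G := by
  funext j
  -- The index j witnesses that there is at least one gate, so m/m = 1.
  have : NeZero A.size := ⟨(Fin.pos j).ne'⟩
  simp only [haarInterp_eq, Function.comp, div_self (NeZero.ne (A.size : ℝ)), sub_self,
    gatePow_zero, one_mul]

theorem measurable_gatePow_pi (t : ℝ) :
    Measurable fun (H : A.Circuit) (j : Fin A.size) => gatePow (H j) t :=
  measurable_pi_lambda _ fun j => (measurable_gatePow t).comp (measurable_pi_apply j)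

theorem isProbabilityMeasure_haarLaw (G : A.Circuit) (θ : ℝ) :
    IsProbabilityMeasure (haarLaw G θ) := by
  refine Measure.isProbabilityMeasure_map (Measurable.aemeasurable ?_)
  rw [haarInterp_eq]
  exact (measurable_mul_gates G).comp (measurable_gatePow_pi _)

theorem haarLaw_eq (G : A.Circuit) (θ : ℝ) :
    haarLaw G θ = (Measure.pi fun j => (haarGate (A.supp j)).map
      fun H => gatePow H (1 - θ / A.size)).map fun H j => H j * G j := by
  have (j : Fin A.size) : IsProbabilityMeasure
      ((haarGate (A.supp j)).map fun H => gatePow H (1 - θ / A.size)) :=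
    Measure.isProbabilityMeasure_map (measurable_gatePow _).aemeasurable
  rw [haarLaw, haarInterp_eq,
    ← Measure.map_map (measurable_mul_gates G) (measurable_gatePow_pi _),
    Measure.pi_map_pi fun j => (measurable_gatePow _).aemeasurable]

theorem overlap_haarLaw (G : A.Circuit) {θ : ℝ} (hθ : 0 ≤ θ) (hθ1 : θ ≤ 1 / 2) :
    Overlap (ENNReal.ofReal (1 - θ / A.size) ^ (32 * A.size)) (haarLaw G θ) (haarLaw G 0) := by
  have ht0 : 0 ≤ θ / A.size := by positivity
  have ht1 : θ / A.size ≤ 1 / 2 := (div_natCast_le_self hθ _).trans hθ1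
  have hP (t : ℝ) (j : Fin A.size) : IsProbabilityMeasure
      ((haarGate (A.supp j)).map fun H => gatePow H t) :=
    Measure.isProbabilityMeasure_map (measurable_gatePow _).aemeasurable
  have hj (j : Fin A.size) : Overlap (ENNReal.ofReal (1 - θ / A.size) ^ 32)
      ((haarGate (A.supp j)).map fun H => gatePow H (1 - θ / A.size))
      ((haarGate (A.supp j)).map fun H => gatePow H (1 - 0 / A.size)) := by
    simp only [zero_div, sub_zero, gatePow_one, Measure.map_id']
    refine (overlap_haarGate (by linarith) (by linarith)).mono
      (pow_le_pow_of_le_one zero_le (by simpa) ?_)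
    -- The exponent 32 is 2 · 4², from gate dimension at most 4.
    have := Nat.pow_le_pow_left (A.card_basis_supp_le j) 2
    omega
  have := (Overlap.pi_const hj).map (measurable_mul_gates G)
  rwa [Fintype.card_fin, ← pow_mul, ← haarLaw_eq, ← haarLaw_eq] at this

end Haar

/-! ### Diagonal gates -/

theorem measurable_zGate {σ : Type} [Fintype σ] [DecidableEq σ] :
    Measurable (zGate : (Basis σ → ℝ) → Gate σ) := by
  refine Continuous.measurable (Continuous.subtype_mk (Continuous.matrix_diagonal ?_) _)
  fun_prop

theorem measurable_xGate {σ : Type} [Fintype σ] [DecidableEq σ] :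
    Measurable (xGate : (Basis σ → ℝ) → Gate σ) :=
  (measurable_zGate.const_mul _).mul_const _

theorem overlap_uniformPhase {s : ℝ} (hs : 0 < s) (hs1 : s ≤ 1) :
    Overlap (ENNReal.ofReal s) (uniformPhase.map (s * ·)) uniformPhase := by
  have : IsProbabilityMeasure (uniformPhase.map (s * ·)) :=
    Measure.isProbabilityMeasure_map (by fun_prop)
  exact Overlap.of_smul_le (by simpa) (smul_map_uniformPhase_le hs hs1)

theorem overlap_pi_pi {ι : Type*} [Fintype ι] {κ : ι → Type*} [∀ i, Fintype (κ i)]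
    {μ ν : ∀ i, κ i → Measure ℝ} [∀ i k, IsProbabilityMeasure (μ i k)]
    [∀ i k, IsProbabilityMeasure (ν i k)] {c : ℝ≥0∞} {d : ℕ} (hc : c ≤ 1)
    (hd : ∀ i, Fintype.card (κ i) ≤ d) (h : ∀ i k, Overlap c (μ i k) (ν i k)) :
    Overlap (c ^ (d * Fintype.card ι)) (Measure.pi fun i => Measure.pi (μ i))
      (Measure.pi fun i => Measure.pi (ν i)) := by
  rw [pow_mul]
  exact Overlap.pi_const fun i =>
    (Overlap.pi_const (h i)).mono (pow_le_pow_of_le_one zero_le hc (hd i))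

theorem measurable_const_mul_pi {κ : Type*} (s : ℝ) :
    Measurable fun (φ : κ → ℝ) k => s * φ k := by
  fun_prop

theorem map_pi_pi_mul {ι : Type*} [Fintype ι] {κ : ι → Type*} [∀ i, Fintype (κ i)]
    (μ : ∀ i, κ i → Measure ℝ) [∀ i k, IsProbabilityMeasure (μ i k)] (s : ℝ) :
    (Measure.pi fun i => Measure.pi (μ i)).map (fun φ i k => s * φ i k) =
      Measure.pi fun i => Measure.pi fun k => (μ i k).map (s * ·) := by
  have h1 (i : ι) (k : κ i) : IsProbabilityMeasure ((μ i k).map (s * ·)) :=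
    Measure.isProbabilityMeasure_map (by fun_prop)
  have h2 (i : ι) : (Measure.pi (μ i)).map (fun φ k => s * φ k) =
      Measure.pi fun k => (μ i k).map (s * ·) :=
    Measure.pi_map_pi fun k => by fun_prop
  have h3 (i : ι) : IsProbabilityMeasure ((Measure.pi (μ i)).map (fun φ k => s * φ k)) :=
    h2 i ▸ inferInstance
  simp_rw [← h2]
  exact Measure.pi_map_pi (f := fun i (φ : κ i → ℝ) k => s * φ k)
    fun i => (measurable_const_mul_pi s).aemeasurable

/-! ### IQP circuits -/

section IQP

variable {n : ℕ} {A : Architecture n}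

theorem measurable_iqpInterp (h : A.Phases) (θ : ℝ) : Measurable (iqpInterp h θ) :=
  measurable_pi_lambda _ fun j => measurable_zGate.comp (by fun_prop)

theorem iqpInterp_size (h φ : A.Phases) : iqpInterp h A.size φ = iqpCircuit h := by
  funext j
  have : NeZero A.size := ⟨(Fin.pos j).ne'⟩
  simp [iqpInterp, iqpCircuit]

theorem isProbabilityMeasure_iqpLaw (h : A.Phases) (θ : ℝ) :
    IsProbabilityMeasure (iqpLaw h θ) :=
  Measure.isProbabilityMeasure_map (measurable_iqpInterp h θ).aemeasurable

theorem iqpLaw_eq (h : A.Phases) (θ : ℝ) :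
    iqpLaw h θ = (Measure.pi fun _ => Measure.pi fun _ =>
      uniformPhase.map ((1 - θ / A.size) * ·)).map (iqpInterp h 0) := by
  rw [iqpLaw, ← map_pi_pi_mul (fun (j : Fin A.size) (_ : Basis (A.supp j)) => uniformPhase),
    Measure.map_map (measurable_iqpInterp h 0) (by fun_prop)]
  congr 1
  funext φ j
  simp [iqpInterp]

theorem overlap_iqpLaw (h : A.Phases) {θ : ℝ} (hθ : 0 ≤ θ) (hθ1 : θ ≤ 1 / 2) :
    Overlap (ENNReal.ofReal (1 - θ / A.size) ^ (4 * A.size)) (iqpLaw h θ) (iqpLaw h 0) := by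
  have ht0 : 0 ≤ θ / A.size := by positivity
  have ht1 : θ / A.size ≤ 1 / 2 := (div_natCast_le_self hθ _).trans hθ1
  have hP : IsProbabilityMeasure (uniformPhase.map ((1 - θ / A.size) * ·)) :=
    Measure.isProbabilityMeasure_map (by fun_prop)
  rw [iqpLaw_eq, iqpLaw]
  refine Overlap.map ?_ (measurable_iqpInterp h 0)
  have := overlap_pi_pi (c := ENNReal.ofReal (1 - θ / A.size))
    (μ := fun (j : Fin A.size) (_ : Basis (A.supp j)) =>
      uniformPhase.map ((1 - θ / A.size) * ·)) (ν := fun _ _ => uniformPhase) (by simpa)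
    A.card_basis_supp_le fun _ _ => overlap_uniformPhase (by linarith) (by linarith)
  rwa [Fintype.card_fin] at this

end IQP

/-! ### QAOA circuits -/

section QAOA

theorem HasDensityOfVariation.overlap_one_sub {V L : ℝ} {μ : Measure ℝ}
    (h : HasDensityOfVariation V μ) (hL : 4 * |V| ≤ L) {t : ℝ} (ht : 0 ≤ t) (ht1 : t ≤ 1 / 2) :
    Overlap (ENNReal.ofReal (1 - L * t)) (μ.map ((1 - t) * ·)) μ := by
  have := h.1
  have hL0 : 0 ≤ L := le_trans (by positivity) hL
  -- The dilation estimate needs a ratio strictly above 1, so t = 0 is separate.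
  rcases ht.eq_or_lt with rfl | ht
  · simpa using Overlap.refl (μ := μ) le_rfl
  refine (h.overlap (by linarith) (by linarith)).mono ?_
  -- This is where t ≤ 1/2 enters; with the factor 2 for the two half-lines it produces 4|V|.
  have h1 : (1 - t)⁻¹ - 1 ≤ 2 * t := by
    rw [sub_le_iff_le_add, inv_le_iff_one_le_mul₀ (by linarith)]
    nlinarith
  rw [ENNReal.ofReal_sub _ (by positivity), ENNReal.ofReal_one]
  refine tsub_le_tsub_left ?_ _
  calc 2 * (ENNReal.ofReal V * ENNReal.ofReal ((1 - t)⁻¹ - 1))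
      ≤ 2 * (ENNReal.ofReal |V| * ENNReal.ofReal (2 * t)) := by
        gcongr
        exact le_abs_self V
    _ = ENNReal.ofReal (4 * |V| * t) := by
        rw [← ENNReal.ofReal_mul (abs_nonneg V), ← ENNReal.ofReal_ofNat 2,
          ← ENNReal.ofReal_mul zero_le_two]
        ring_nf
    _ ≤ ENNReal.ofReal (L * t) := by gcongr

section Phase

variable {σ : Type} [Fintype σ] [DecidableEq σ]

theorem measurable_mulVec (B : Matrix (Basis σ) (Basis σ) ℝ) : Measurable fun ξ => B.mulVec ξ :=
  (Continuous.matrix_mulVec continuous_const continuous_id).measurable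

theorem isProbabilityMeasure_zPhaseLaw (B : Matrix (Basis σ) (Basis σ) ℝ)
    (μ : Basis σ → Measure ℝ) [∀ z, IsProbabilityMeasure (μ z)] :
    IsProbabilityMeasure (zPhaseLaw B μ) :=
  Measure.isProbabilityMeasure_map (measurable_mulVec B).aemeasurable

/-- By linearity, contracting correlated phases amounts to contracting the independent variables
behind them, whatever the coefficients, even a singular matrix. -/
theorem map_zPhaseLaw_mul (B : Matrix (Basis σ) (Basis σ) ℝ)
    (μ : Basis σ → Measure ℝ) [∀ z, IsProbabilityMeasure (μ z)] (s : ℝ) :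
    (zPhaseLaw B μ).map (fun φ z => s * φ z) = zPhaseLaw B fun z => (μ z).map (s * ·) := by
  have h1 (z : Basis σ) : IsProbabilityMeasure ((μ z).map (s * ·)) :=
    Measure.isProbabilityMeasure_map (by fun_prop)
  rw [zPhaseLaw, zPhaseLaw, ← Measure.pi_map_pi fun z => by fun_prop,
    Measure.map_map (by fun_prop) (measurable_mulVec B),
    Measure.map_map (measurable_mulVec B) (by fun_prop)]
  congr 1
  funext ξ
  exact (B.mulVec_smul s ξ).symm

end Phase

variable {n : ℕ} {A : Architecture n}

theorem measurable_qaoaInterp (hz : A.Phases) (hx : XPhases n) (θ : ℝ) :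
    Measurable (qaoaInterp hz hx θ) := by
  refine Measurable.prodMk (measurable_pi_lambda _ fun j => measurable_zGate.comp ?_)
    (measurable_pi_lambda _ fun q => measurable_xGate.comp ?_) <;> fun_prop

theorem qaoaInterp_size (hz φz : A.Phases) (hx φx : XPhases n) :
    qaoaInterp hz hx ((A.size + n : ℕ) : ℝ) (φz, φx) = qaoaCircuit hz hx := by
  refine Prod.ext (funext fun j => ?_) (funext fun q => ?_)
  · have : ((A.size + n : ℕ) : ℝ) ≠ 0 := by
      have := Fin.pos j
      exact_mod_cast (by omega : A.size + n ≠ 0)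
    simp only [qaoaInterp, qaoaCircuit, div_self this, sub_self, zero_mul, add_zero]
  · have : ((A.size + n : ℕ) : ℝ) ≠ 0 := by
      have := Fin.pos q
      exact_mod_cast (by omega : A.size + n ≠ 0)
    simp only [qaoaInterp, qaoaCircuit, div_self this, sub_self, zero_mul, add_zero]

variable (B : ∀ j, Matrix (Basis (A.supp j)) (Basis (A.supp j)) ℝ)
  (μ : ∀ j, Basis (A.supp j) → Measure ℝ)

theorem isProbabilityMeasure_qaoaLaw [∀ j z, IsProbabilityMeasure (μ j z)] (hz : A.Phases)
    (hx : XPhases n) (θ : ℝ) : IsProbabilityMeasure (qaoaLaw B μ hz hx θ) :=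
  have (j : Fin A.size) := isProbabilityMeasure_zPhaseLaw (B j) (μ j)
  Measure.isProbabilityMeasure_map (measurable_qaoaInterp hz hx θ).aemeasurable

theorem qaoaLaw_eq [∀ j z, IsProbabilityMeasure (μ j z)] (hz : A.Phases)
    (hx : XPhases n) (θ : ℝ) : qaoaLaw B μ hz hx θ =
      ((Measure.pi fun j => zPhaseLaw (B j) fun z =>
          (μ j z).map ((1 - θ / ((A.size + n : ℕ) : ℝ)) * ·)).prod
        (Measure.pi fun _ => Measure.pi fun _ =>
          uniformPhase.map ((1 - θ / ((A.size + n : ℕ) : ℝ)) * ·))).map (qaoaInterp hz hx 0) := by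
  set s := 1 - θ / ((A.size + n : ℕ) : ℝ) with hs
  have h1 (j : Fin A.size) := isProbabilityMeasure_zPhaseLaw (B j) (μ j)
  have h2 (j : Fin A.size) : IsProbabilityMeasure
      ((zPhaseLaw (B j) (μ j)).map (fun φ z => s * φ z)) :=
    Measure.isProbabilityMeasure_map (measurable_const_mul_pi s).aemeasurable
  simp_rw [← map_zPhaseLaw_mul]
  rw [qaoaLaw, ← Measure.pi_map_pi fun j => (measurable_const_mul_pi s).aemeasurable,
    ← map_pi_pi_mul (fun (q : Fin n) (_ : Basis ({q} : Finset (Fin n))) => uniformPhase),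
    Measure.map_prod_map _ _ (by fun_prop) (by fun_prop),
    Measure.map_map (measurable_qaoaInterp hz hx 0) (by fun_prop)]
  congr 1
  funext φ
  simp [qaoaInterp, hs]

theorem overlap_qaoaLaw {V L : ℝ} (hμ : ∀ j z, HasDensityOfVariation V (μ j z)) (hL : 4 * |V| ≤ L)
    (hL1 : 1 ≤ L) (hz : A.Phases) (hx : XPhases n) {θ : ℝ} (hθ : 0 ≤ θ) (hθ1 : θ ≤ 1 / 2) :
    Overlap (ENNReal.ofReal (1 - L * θ / ((A.size + n : ℕ) : ℝ)) ^ (4 * (A.size + n)))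
      (qaoaLaw B μ hz hx θ) (qaoaLaw B μ hz hx 0) := by
  have hP (j : Fin A.size) (z : Basis (A.supp j)) : IsProbabilityMeasure (μ j z) := (hμ j z).1
  have hZ (j : Fin A.size) := isProbabilityMeasure_zPhaseLaw (B j) (μ j)
  rw [qaoaLaw_eq, qaoaLaw]
  set t := θ / ((A.size + n : ℕ) : ℝ)
  rw [mul_div_assoc, mul_add, pow_add]
  have ht0 : 0 ≤ t := by positivity
  have ht1 : t ≤ 1 / 2 := (div_natCast_le_self hθ _).trans hθ1
  have hc : ENNReal.ofReal (1 - L * t) ≤ 1 := by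
    simpa using mul_nonneg (zero_le_one.trans hL1) ht0
  have hP' (j : Fin A.size) (z : Basis (A.supp j)) :
      IsProbabilityMeasure ((μ j z).map ((1 - t) * ·)) :=
    Measure.isProbabilityMeasure_map (by fun_prop)
  have hZ' (j : Fin A.size) :=
    isProbabilityMeasure_zPhaseLaw (B j) fun z => (μ j z).map ((1 - t) * ·)
  have hU : IsProbabilityMeasure (uniformPhase.map ((1 - t) * ·)) :=
    Measure.isProbabilityMeasure_map (by fun_prop)
  have hoverZ (j : Fin A.size) : Overlap (ENNReal.ofReal (1 - L * t) ^ 4)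
      (zPhaseLaw (B j) fun z => (μ j z).map ((1 - t) * ·)) (zPhaseLaw (B j) (μ j)) :=
    ((Overlap.pi_const fun z => (hμ j z).overlap_one_sub hL ht0 ht1).mono
      (pow_le_pow_of_le_one zero_le hc (A.card_basis_supp_le j))).map (measurable_mulVec (B j))
  -- Since L ≥ 1, the mass 1 - t of a uniform phase is at least 1 - Lt, so both layers share one
  -- base.
  have hoverX := overlap_pi_pi (d := 4)
    (μ := fun (q : Fin n) (_ : Basis ({q} : Finset (Fin n))) => uniformPhase.map ((1 - t) * ·))
    (ν := fun _ _ => uniformPhase) hc (by simp) fun _ _ =>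
      (overlap_uniformPhase (s := 1 - t) (by linarith) (by linarith)).mono
        (ENNReal.ofReal_le_ofReal (by nlinarith))
  have hoverZ' := Overlap.pi_const hoverZ
  rw [← pow_mul, Fintype.card_fin] at hoverZ'
  rw [Fintype.card_fin] at hoverX
  exact (hoverZ'.prod hoverX).map (measurable_qaoaInterp hz hx 0)

end QAOA

end RandomCircuit

/-! ### Choice of the constants -/

open RandomCircuit in
theorem mainTheorem9 :
    -- Haar random circuits
    ((∀ (n : ℕ) (A : Architecture n) (G H : A.Circuit),
        haarInterp G A.size H = G ∧
        A.operator (haarInterp G A.size H) = A.operator G) ∧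
      ∀ ε : ℝ, 0 < ε → ∃ c : ℝ, 0 < c ∧
        ∀ (n : ℕ) (A : Architecture n) (G : A.Circuit) (N : ℕ), (∀ j, A.gateDim j ≤ N) →
        ∀ θ : ℝ, 0 ≤ θ → θ ≤ c / N →
          IsProbabilityMeasure (haarLaw G θ) ∧ IsProbabilityMeasure (haarLaw G 0) ∧
          tvDist (haarLaw G θ) (haarLaw G 0) ≤ ε) ∧
    -- QAOA circuits
    ((∀ (n : ℕ) (A : Architecture n) (hz φz : A.Phases) (hx φx : XPhases n),
        qaoaInterp hz hx ((A.size + n : ℕ) : ℝ) (φz, φx) = qaoaCircuit hz hx ∧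
        qaoaOperator (qaoaInterp hz hx ((A.size + n : ℕ) : ℝ) (φz, φx)) =
          qaoaOperator (qaoaCircuit hz hx)) ∧
      ∀ V ε : ℝ, 0 < ε → ∃ c : ℝ, 0 < c ∧
        ∀ (n : ℕ) (A : Architecture n)
          (B : ∀ j, Matrix (Basis (A.supp j)) (Basis (A.supp j)) ℝ)
          (μ : ∀ j, Basis (A.supp j) → Measure ℝ), (∀ j z, HasDensityOfVariation V (μ j z)) →
        ∀ (hz : A.Phases) (hx : XPhases n) (N : ℕ), 2 ≤ N → (∀ j, A.gateDim j ≤ N) →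
        ∀ θ : ℝ, 0 ≤ θ → θ ≤ c / N →
          IsProbabilityMeasure (qaoaLaw B μ hz hx θ) ∧
          IsProbabilityMeasure (qaoaLaw B μ hz hx 0) ∧
          tvDist (qaoaLaw B μ hz hx θ) (qaoaLaw B μ hz hx 0) ≤ ε) ∧
    -- IQP circuits
    ((∀ (n : ℕ) (A : Architecture n) (h φ : A.Phases),
        iqpInterp h A.size φ = iqpCircuit h ∧
        iqpOperator (iqpInterp h A.size φ) = iqpOperator (iqpCircuit h)) ∧
      ∀ ε : ℝ, 0 < ε → ∃ c : ℝ, 0 < c ∧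
        ∀ (n : ℕ) (A : Architecture n) (h : A.Phases) (N : ℕ), (∀ j, A.gateDim j ≤ N) →
        ∀ θ : ℝ, 0 ≤ θ → θ ≤ c / N →
          IsProbabilityMeasure (iqpLaw h θ) ∧ IsProbabilityMeasure (iqpLaw h 0) ∧
          tvDist (iqpLaw h θ) (iqpLaw h 0) ≤ ε) := by
  -- Gates have dimension at most 4, so θ ≤ c suffices and N can be dropped. For N = 0 the quotient
  -- is 0.
  have hdiv {c θ : ℝ} (hc : 0 ≤ c) {N : ℕ} (h : θ ≤ c / N) : θ ≤ c :=
    h.trans (div_natCast_le_self hc N)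
  refine ⟨⟨fun n A G H => ?_, fun ε hε => ?_⟩, ⟨fun n A hz φz hx φx => ?_, fun V ε hε => ?_⟩,
    fun n A h φ => ?_, fun ε hε => ?_⟩
  · rw [haarInterp_size]
    exact ⟨rfl, rfl⟩
  · have hc : 0 < min (1 / 2) (ε / 32) := by positivity
    refine ⟨_, hc, fun n A G N _ θ hθ hθc => ?_⟩
    obtain ⟨h1, h2⟩ := le_min_iff.1 (hdiv hc.le hθc)
    have hP := isProbabilityMeasure_haarLaw G
    refine ⟨hP θ, hP 0, (tvDist_le_of_overlap_pow hθ (by linarith)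
      (overlap_haarLaw G hθ h1)).trans ?_⟩
    push_cast
    linarith
  · rw [qaoaInterp_size]
    exact ⟨rfl, rfl⟩
  · set L := max 1 (4 * |V|)
    have hL1 : 1 ≤ L := le_max_left _ _
    have hL0 : 0 < L := one_pos.trans_le hL1
    -- The three bounds give θ ≤ 1/2 for the contraction estimates, Lθ ≤ 1 for Bernoulli's
    -- inequality, and 4Lθ ≤ ε.
    have hc : 0 < min (1 / 2) (min (1 / L) (ε / (4 * L))) := by positivity
    refine ⟨_, hc, fun n A B μ hμ hz hx N _ _ θ hθ hθc => ?_⟩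
    obtain ⟨h1, h2⟩ := le_min_iff.1 (hdiv hc.le hθc)
    obtain ⟨h2, h3⟩ := le_min_iff.1 h2
    rw [le_div_iff₀ (by positivity)] at h2 h3
    have hμP (j : Fin A.size) (z : Basis (A.supp j)) : IsProbabilityMeasure (μ j z) := (hμ j z).1
    have hP := isProbabilityMeasure_qaoaLaw B μ hz hx
    refine ⟨hP θ, hP 0, (tvDist_le_of_overlap_pow (θ := L * θ) (by positivity) (by linarith)
      (overlap_qaoaLaw B μ hμ (le_max_right _ _) hL1 hz hx hθ h1)).trans ?_⟩
    push_cast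
    linarith
  · rw [iqpInterp_size]
    exact ⟨rfl, rfl⟩
  · have hc : 0 < min (1 / 2) (ε / 4) := by positivity
    refine ⟨_, hc, fun n A h N _ θ hθ hθc => ?_⟩
    obtain ⟨h1, h2⟩ := le_min_iff.1 (hdiv hc.le hθc)
    have hP := isProbabilityMeasure_iqpLaw h
    refine ⟨hP θ, hP 0, (tvDist_le_of_overlap_pow hθ (by linarith)
      (overlap_iqpLaw h hθ h1)).trans ?_⟩
    push_cast
    linarith
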